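/- **Directed graph removal lemma with a tower bound of logarithmic height.** Directed graphs are finite and have at most one edge $(u,v)$ for each ordered pair of vertices; both $(u,v)$ and $(v,u)$ may be edges (loops are allowed too, and the loopless case is included). A copy of $H$ in $G$ is a (not necessarily induced) subgraph of $G$ isomorphic to $H$, and $G$ is $H$-free if it contains no copy of $H$. The tower of twos of height $k$ is $T(k)$, where $T(0)=1$ and $T(k+1)=2^{T(k)}$. For every $h$ there is a constant $C=C(h)>0$, depending only on $h$, such that the following holds for every directed graph $H$ on $h$ vertices and every $\epsilon>0$. If $$\delta^{-1}=T\bigl(\lceil C\max(1,\log(1/\epsilon))\rceil\bigr),$$ a tower of twos of height $O_h(\log(1/\epsilon))$ for small $\epsilon$ (say $\epsilon\le 1/2$), then every directed graph $G$ on $n$ vertices with at most $\delta n^h$ copies of $H$ can be made $H$-free by removing at most $\epsilon n^2$ edges. -/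

import Mathlib

namespace DigraphRemoval

/-- The tower of twos of height `k`: `tower 0 = 1` and `tower (k + 1) = 2 ^ tower k`. -/
def tower : ℕ → ℕ
  | 0 => 1
  | k + 1 => 2 ^ tower k

/-- The injection `f` places `H` inside `G`: it sends every edge of `H` to an edge of `G`
(with the same direction; the copy need not be induced). -/
def IsPlacement {V W : Type*} (H : Digraph V) (G : Digraph W) (f : V ↪ W) : Prop :=
  ∀ u v : V, H.Adj u v → G.Adj (f u) (f v)

/-- The image of `H` under an injection `f`, recorded as its vertex set together with its set of
directed edges. -/
def image {V W : Type*} (H : Digraph V) (f : V ↪ W) : Set W × Set (W × W) :=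
  (Set.range f, {e | ∃ u v : V, H.Adj u v ∧ e = (f u, f v)})

/-- The set of copies of `H` in `G`, that is, of the (not necessarily induced) subgraphs of `G`
that are isomorphic to `H`. -/
def copies {V W : Type*} (H : Digraph V) (G : Digraph W) : Set (Set W × Set (W × W)) :=
  {S | ∃ f : V ↪ W, IsPlacement H G f ∧ S = image H f}

/-- The number of (unlabeled) copies of `H` in `G`. -/
noncomputable def copyCount {V W : Type*} (H : Digraph V) (G : Digraph W) : ℕ :=
  (copies H G).ncard

/-- `G` is `H`-free: it contains no copy of `H`. -/
def IsFree {V W : Type*} (H : Digraph V) (G : Digraph W) : Prop :=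
  copies H G = ∅

/-- The directed edges of `G` that are not edges of `G'`. -/
def removedEdges {W : Type*} (G G' : Digraph W) : Set (W × W) :=
  {e | G.Adj e.1 e.2 ∧ ¬ G'.Adj e.1 e.2}

end DigraphRemoval

/-! For i < j joined in `H` in some direction, let `E i j` be the pairs of vertices of `G` that
carry every edge `H` demands between i and j. Both directions thus become one binary constraint, and
the homomorphisms of a loopless `H` are the solutions of an h-partite system with m constraints
(`loopless_removal`). If `H` has a loop, deleting the loops of `G` is enough.

In `partite_removal`, take a maximal family F of solutions, no two of which agree on a constrained
pair. If F is small, the pairs it uses meet every solution and can be deleted. Otherwise replace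
each constraint by the |F| pairs that F uses, and refine a vertex partition repeatedly. The
potential is the sum over constraints of the total of d log d, where d is the density on the pair of
cells containing a given pair of vertices. It starts at m|F| log(|F|/n²) and is never positive. As
long as solutions are few, each refinement raises it by |F|/(32m). The factor |F| cancels, so about
32m² log(m/ε) steps exhaust the potential. Each step costs a bounded number of exponentials, hence a
tower of logarithmic height.

The gain in one step (`exists_refinement`) arises as follows. Take a member of F whose constrained
pairs avoid small cells and sparse pairs of cells. By the counting lemma `card_solutions_ge`, the
scarcity of solutions forces every large subbox of the product of its cells to have a sparse pair of
sides. Packing such subboxes (`exists_sparse_boxes`) and averaging over two-dimensional fibres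
(`exists_sparse_fibre`) gives, for some constraint, few rectangles that cover a fraction 1/(2m) of a
pair of cells with at most half its density. Resolving these rectangles gains entropy in proportion
to the edges in that pair of cells (`entropy_increment_of_isShattered`). -/

namespace DigraphRemoval
open Finset

/-! ### Conditional averages and the entropy of a colouring. -/

/-- The average of `r` over the fibre of the colouring `P` that contains `ω`. -/
noncomputable def condAvg {Ω κ : Type*} [Fintype Ω] [DecidableEq κ] (P : Ω → κ) (r : Ω → ℝ)
    (ω : Ω) : ℝ :=
  (∑ ω' with P ω' = P ω, r ω') / (#{ω' | P ω' = P ω} : ℝ)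

theorem condAvg_congr {Ω κ : Type*} [Fintype Ω] [DecidableEq κ] {P : Ω → κ} (r : Ω → ℝ)
    {ω ω' : Ω} (h : P ω = P ω') : condAvg P r ω = condAvg P r ω' := by
  simp only [condAvg, h]

theorem condAvg_nonneg {Ω κ : Type*} [Fintype Ω] [DecidableEq κ] (P : Ω → κ) {r : Ω → ℝ}
    (hr : ∀ ω, 0 ≤ r ω) (ω : Ω) : 0 ≤ condAvg P r ω :=
  div_nonneg (sum_nonneg fun _ _ => hr _) (Nat.cast_nonneg _)

theorem card_fibre_pos {Ω κ : Type*} [Fintype Ω] [DecidableEq κ] (P : Ω → κ) (ω : Ω) :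
    (0 : ℝ) < #{ω' | P ω' = P ω} := by
  exact_mod_cast card_pos.2 ⟨ω, by simp⟩

theorem condAvg_le_one {Ω κ : Type*} [Fintype Ω] [DecidableEq κ] (P : Ω → κ) {r : Ω → ℝ}
    (hr : ∀ ω, r ω ≤ 1) (ω : Ω) : condAvg P r ω ≤ 1 := by
  rw [condAvg, div_le_one (card_fibre_pos P ω)]
  calc ∑ ω' with P ω' = P ω, r ω' ≤ ∑ ω' with P ω' = P ω, (1 : ℝ) := sum_le_sum fun _ _ => hr _
    _ = _ := by simp

/-- Averaging over fibres does not change the integral against a function of the colour. -/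
theorem sum_mul_condAvg {Ω κ : Type*} [Fintype Ω] [DecidableEq κ] (P : Ω → κ) (r ψ : Ω → ℝ)
    (hψ : ∀ ω ω', P ω = P ω' → ψ ω = ψ ω') :
    ∑ ω, ψ ω * condAvg P r ω = ∑ ω, ψ ω * r ω := by
  rw [← sum_fiberwise_of_maps_to (s := univ) (t := univ.image P) (g := P)
      (fun ω _ => mem_image_of_mem _ (mem_univ ω)),
    ← sum_fiberwise_of_maps_to (s := univ) (t := univ.image P) (g := P)
      (fun ω _ => mem_image_of_mem _ (mem_univ ω))]
  refine sum_congr rfl fun s hs => ?_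
  obtain ⟨ω₀, -, rfl⟩ := mem_image.1 hs
  have h1 : ∀ ω ∈ univ.filter (fun ω => P ω = P ω₀),
      ψ ω * condAvg P r ω = ψ ω₀ * condAvg P r ω₀ := fun ω hω => by
    have := (mem_filter.1 hω).2
    rw [hψ _ _ this, condAvg_congr r this]
  have h2 : ∀ ω ∈ univ.filter (fun ω => P ω = P ω₀), ψ ω * r ω = ψ ω₀ * r ω := fun ω hω => by
    rw [hψ _ _ (mem_filter.1 hω).2]
  rw [sum_congr rfl h1, sum_congr rfl h2, sum_const, ← mul_sum, nsmul_eq_mul, condAvg]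
  have := card_fibre_pos P ω₀
  field_simp

theorem sum_condAvg {Ω κ : Type*} [Fintype Ω] [DecidableEq κ] (P : Ω → κ) (r : Ω → ℝ)
    (R : Finset Ω) (hR : ∀ ω ω', P ω = P ω' → ω ∈ R → ω' ∈ R) :
    ∑ ω ∈ R, condAvg P r ω = ∑ ω ∈ R, r ω := by
  classical
  have := sum_mul_condAvg P r (fun ω => if ω ∈ R then 1 else 0) (fun ω ω' h => by
    by_cases h1 : ω ∈ R
    · simp [h1, hR _ _ h h1]
    · have : ω' ∉ R := fun h2 => h1 (hR _ _ h.symm h2)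
      simp [h1, this])
  simpa using this

/-- The mean of `x log x` of the fibre averages, up to normalisation. -/
noncomputable def entropy {Ω κ : Type*} [Fintype Ω] [DecidableEq κ] (P : Ω → κ) (r : Ω → ℝ) : ℝ :=
  ∑ ω, condAvg P r ω * Real.log (condAvg P r ω)

theorem entropy_nonpos {Ω κ : Type*} [Fintype Ω] [DecidableEq κ] (P : Ω → κ) {r : Ω → ℝ}
    (h0 : ∀ ω, 0 ≤ r ω) (h1 : ∀ ω, r ω ≤ 1) : entropy P r ≤ 0 :=
  sum_nonpos fun ω _ => mul_nonpos_of_nonneg_of_nonpos (condAvg_nonneg P h0 ω)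
    (Real.log_nonpos (condAvg_nonneg P h0 ω) (condAvg_le_one P h1 ω))

/-- The convex function t log t lies above its tangent at `v`; the case x = 0 uses the convention 0
log 0 = 0. -/
theorem mul_log_tangent {x v : ℝ} (hx : 0 ≤ x) (hv : 0 < v) :
    x * Real.log v + x - v ≤ x * Real.log x := by
  rcases hx.eq_or_lt with rfl | hx
  · simp [hv.le]
  · have h := Real.log_le_sub_one_of_pos (div_pos hv hx)
    rw [Real.log_div hv.ne' hx.ne'] at h
    have h2 := mul_le_mul_of_nonneg_left h hx.le
    have : x * (v / x - 1) = v - x := by field_simp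
    linarith

theorem condAvg_eq_zero_of_refine {Ω κ κ' : Type*} [Fintype Ω] [DecidableEq κ] [DecidableEq κ']
    {P : Ω → κ} {P' : Ω → κ'} {r : Ω → ℝ} (h0 : ∀ ω, 0 ≤ r ω)
    (hP : ∀ ω ω', P' ω = P' ω' → P ω = P ω') {ω : Ω} (h : condAvg P r ω = 0) :
    condAvg P' r ω = 0 := by
  rw [condAvg, div_eq_zero_iff, or_iff_left (card_fibre_pos P ω).ne',
    sum_eq_zero_iff_of_nonneg fun _ _ => h0 _] at h
  rw [condAvg, sum_eq_zero, zero_div]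
  intro ω' hω'
  exact h ω' (by simpa using hP _ _ (by simpa using hω'))

/-- Refining a colouring raises the entropy, and it does so substantially if on the set `R`
the function `r` is much smaller than its coarse average. -/
theorem entropy_increment {Ω κ κ' : Type*} [Fintype Ω] [DecidableEq κ] [DecidableEq κ']
    (P : Ω → κ) (P' : Ω → κ') {r : Ω → ℝ} (h0 : ∀ ω, 0 ≤ r ω)
    (hP : ∀ ω ω', P' ω = P' ω' → P ω = P ω') (R : Finset Ω)
    (hR : ∀ ω ω', P' ω = P' ω' → ω ∈ R → ω' ∈ R) :
    entropy P r + ∑ ω ∈ R, (condAvg P r ω / 2 - r ω * Real.log 2) ≤ entropy P' r := by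
  classical
  set D := condAvg P r with hD
  set D' := condAvg P' r with hD'
  -- Tangent to t log t at `D ω` off `R`, but at `D ω / 2` on `R`, where the fine average is
  -- expected to be at most half the coarse one. Summing, the linear terms cancel because both
  -- averages have the same integral.
  have key : ∀ ω, Real.log (D ω) * D' ω + D' ω - D ω
      + (if ω ∈ R then D ω / 2 - D' ω * Real.log 2 else 0) ≤ D' ω * Real.log (D' ω) := by
    intro ω
    have hd' : 0 ≤ D' ω := condAvg_nonneg P' h0 ω
    rcases (condAvg_nonneg P h0 ω).eq_or_lt with hz | hpos
    · have hz' : D' ω = 0 := condAvg_eq_zero_of_refine h0 hP hz.symm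
      have : D ω = 0 := hz.symm
      simp [hz', this]
    · have hpos : 0 < D ω := hpos
      split_ifs with h
      · have := mul_log_tangent hd' (half_pos hpos)
        rw [Real.log_div hpos.ne' two_ne_zero] at this
        linarith
      · have := mul_log_tangent hd' hpos
        linarith
  have hs := sum_le_sum fun ω (_ : ω ∈ (univ : Finset Ω)) => key ω
  rw [sum_add_distrib, sum_sub_distrib, sum_add_distrib,
    sum_mul_condAvg P' r (fun ω => Real.log (D ω))
      (fun ω ω' h => by simp only [hD, condAvg_congr r (hP _ _ h)]),
    ← sum_mul_condAvg P r (fun ω => Real.log (D ω))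
      (fun ω ω' h => by simp only [hD, condAvg_congr r h]),
    hD', hD, sum_condAvg P' r univ (by simp), sum_condAvg P r univ (by simp),
    sum_ite_mem, univ_inter, sum_sub_distrib, ← sum_mul, sum_condAvg P' r R hR, sum_mul] at hs
  rw [sum_sub_distrib]
  have e1 : entropy P r = ∑ ω, Real.log (condAvg P r ω) * condAvg P r ω :=
    sum_congr rfl fun _ _ => mul_comm _ _
  rw [e1, entropy]
  linarith

/-! ### Counting solutions in a box without sparse pairs. -/

/-- The points of the box `U` that satisfy the binary constraints `E i j` for all `(i, j)`
with `C i j`. -/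
noncomputable def solutions {W : Type*} [DecidableEq W] {h : ℕ} (C : Fin h → Fin h → Prop)
    (E : Fin h → Fin h → Finset (W × W)) (U : Fin h → Finset W) : Finset (Fin h → W) := by
  classical exact (Fintype.piFinset U).filter fun x => ∀ i j, C i j → (x i, x j) ∈ E i j

theorem mem_solutions {W : Type*} [DecidableEq W] {h : ℕ} {C : Fin h → Fin h → Prop}
    {E : Fin h → Fin h → Finset (W × W)} {U : Fin h → Finset W} {x : Fin h → W} :
    x ∈ solutions C E U ↔ (∀ i, x i ∈ U i) ∧ ∀ i j, C i j → (x i, x j) ∈ E i j := by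
  simp [solutions]

theorem prod_card_le_of_mul_le {h : ℕ} {α : ℝ} (hα : 0 ≤ α) {f g : Fin h → ℝ}
    (hf : ∀ i, 0 ≤ f i) (hfg : ∀ i, α * f i ≤ g i) : α ^ h * ∏ i, f i ≤ ∏ i, g i := by
  calc α ^ h * ∏ i, f i = ∏ i, (α * f i) := by simp [prod_mul_distrib]
    _ ≤ _ := prod_le_prod (fun i _ => mul_nonneg hα (hf i)) fun i _ => hfg i

theorem card_product_inter {W : Type*} [DecidableEq W] (A B : Finset W) (E : Finset (W × W)) :
    #((A ×ˢ B) ∩ E) = ∑ v ∈ A, #(B.filter fun w => (v, w) ∈ E) := by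
  rw [← filter_mem_eq_inter, card_filter, sum_product]
  simp only [card_filter]

theorem peel_bound {α u g q : ℝ} (hα : 0 < α) (hα1 : α ≤ 1) (hu : 0 ≤ u) (hq : 0 ≤ q)
    (hg : u / 2 ≤ g) (h : ℕ) :
    (α ^ (h + 1) / 2) ^ (h + 1) * (u * q) ≤ g * ((α ^ h / 2) ^ h * (α ^ h * q)) := by
  have e : (α ^ (h + 1) / 2) ^ (h + 1) = (α ^ (h + 1) / 2) * ((α ^ h / 2) ^ h * α ^ h) := by
    rw [← mul_pow, pow_succ' (α ^ (h + 1) / 2)]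
    congr 2
    rw [pow_succ]; ring
  calc (α ^ (h + 1) / 2) ^ (h + 1) * (u * q)
      = (α ^ (h + 1) / 2) * (u * ((α ^ h / 2) ^ h * (α ^ h * q))) := by rw [e]; ring
    _ ≤ (1 / 2) * (u * ((α ^ h / 2) ^ h * (α ^ h * q))) := by
        gcongr; exact pow_le_one₀ hα.le hα1
    _ = (u / 2) * ((α ^ h / 2) ^ h * (α ^ h * q)) := by ring
    _ ≤ _ := by gcongr

/-- If no constraint is sparse on any pair of large subsets, then a box has many solutions. -/
theorem card_solutions_ge {W : Type*} [DecidableEq W] {α : ℝ} (hα : 0 < α) (hα1 : α ≤ 1) (K : ℕ)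
    (hK : 0 < K) : ∀ (h : ℕ) (_ : h ≤ K) (C : Fin h → Fin h → Prop)
      (_ : ∀ i j, C i j → i < j) (E : Fin h → Fin h → Finset (W × W)) (U : Fin h → Finset W)
      (η : ℝ) (_ : 0 ≤ η) (_ : η ≤ α ^ h / (2 * K))
      (_ : ∀ i j, C i j → ∀ A ⊆ U i, ∀ B ⊆ U j, η * #(U i) ≤ #A → η * #(U j) ≤ #B →
        ¬ ((#((A ×ˢ B) ∩ E i j) : ℝ) ≤ α * (#A * #B))),
      (α ^ h / 2) ^ h * ∏ i, (#(U i) : ℝ) ≤ #(solutions C E U) := by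
  classical
  intro h
  induction h with
  | zero =>
    intro _ C _ E U η _ _ _
    have : solutions C E U = {fun i => i.elim0} := by
      ext x
      simp only [mem_solutions, mem_singleton]
      exact ⟨fun _ => funext fun i => i.elim0, fun _ => ⟨fun i => i.elim0, fun i => i.elim0⟩⟩
    simp [this]
  | succ h ih =>
    intro hhK C hC E U η hη0 hη hden
    have hKr : (0 : ℝ) < K := by exact_mod_cast hK
    have hη2 : η ≤ 1 / (2 * K) :=
      hη.trans (by gcongr; exact pow_le_one₀ hα.le hα1)
    have hη1 : η ≤ 1 := by
      refine hη2.trans ?_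
      rw [div_le_one (by positivity)]
      have : (1 : ℝ) ≤ K := by exact_mod_cast hK
      linarith
    set N : W → Fin h → Finset W := fun v j =>
      if C 0 j.succ then (U j.succ).filter (fun w => (v, w) ∈ E 0 j.succ) else U j.succ with hN
    have hNsub : ∀ v j, N v j ⊆ U j.succ := fun v j => by
      simp only [hN]; split_ifs
      · exact filter_subset _ _
      · exact subset_rfl
    -- Values of the first coordinate with too few neighbours in side j. Together with the whole of
    -- that side they form a sparse pair, so there are at most η|U 0| of them. Since hη ≤ 1/2, at
    -- least half of `U 0` remains.
    set bad : Fin h → Finset W := fun j =>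
      (U 0).filter fun v => (#(N v j) : ℝ) < α * #(U j.succ) with hbad
    set good : Finset W := (U 0).filter fun v => ∀ j, α * #(U j.succ) ≤ (#(N v j) : ℝ) with hgood
    have hbadcard : ∀ j, (#(bad j) : ℝ) ≤ η * #(U 0) := by
      intro j
      by_cases hc : C 0 j.succ
      · by_contra hcon
        push Not at hcon
        refine hden 0 j.succ hc (bad j) (filter_subset _ _) (U j.succ) subset_rfl hcon.le
          (by nlinarith [Nat.cast_nonneg (α := ℝ) #(U j.succ)]) ?_
        have h1 : #((bad j ×ˢ U j.succ) ∩ E 0 j.succ) = ∑ v ∈ bad j, #(N v j) := by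
          rw [card_product_inter]
          simp [hN, hc]
        rw [h1, Nat.cast_sum]
        calc ∑ v ∈ bad j, (#(N v j) : ℝ) ≤ ∑ v ∈ bad j, α * #(U j.succ) :=
              sum_le_sum fun v hv => (mem_filter.1 hv).2.le
          _ = _ := by rw [sum_const, nsmul_eq_mul]; ring
      · have : bad j = ∅ := by
          refine filter_eq_empty_iff.2 fun v _ => ?_
          simp only [hN, hc, if_false, not_lt]
          nlinarith [Nat.cast_nonneg (α := ℝ) #(U j.succ)]
        simp [this]; positivity
    have hgoodcard : (#(U 0) : ℝ) / 2 ≤ #good := by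
      have hsub : U 0 ⊆ good ∪ univ.biUnion bad := by
        intro v hv
        by_cases hg : ∀ j, α * #(U j.succ) ≤ (#(N v j) : ℝ)
        · exact mem_union_left _ (mem_filter.2 ⟨hv, hg⟩)
        · push Not at hg
          obtain ⟨j, hj⟩ := hg
          exact mem_union_right _ (mem_biUnion.2 ⟨j, mem_univ _, mem_filter.2 ⟨hv, hj⟩⟩)
      have h1 : (#(U 0) : ℝ) ≤ #good + ∑ j, (#(bad j) : ℝ) := by
        have := (card_le_card hsub).trans ((card_union_le _ _).trans
          (Nat.add_le_add_left card_biUnion_le _))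
        exact_mod_cast this
      have h2 : ∑ j, (#(bad j) : ℝ) ≤ #(U 0) / 2 := by
        calc ∑ j, (#(bad j) : ℝ) ≤ ∑ _j : Fin h, η * #(U 0) := sum_le_sum fun j _ => hbadcard j
          _ = h * η * #(U 0) := by simp; ring
          _ ≤ K * (1 / (2 * K)) * #(U 0) := by
            gcongr
            exact_mod_cast (Nat.le_succ h).trans hhK
          _ = _ := by field_simp
      linarith
    set C' : Fin h → Fin h → Prop := fun i j => C i.succ j.succ
    set E' : Fin h → Fin h → Finset (W × W) := fun i j => E i.succ j.succ
    have hfib : ∀ v ∈ good, (α ^ h / 2) ^ h * (α ^ h * ∏ j : Fin h, (#(U j.succ) : ℝ))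
        ≤ (#((solutions C E U).filter fun x => x 0 = v) : ℝ) := by
      intro v hv
      obtain ⟨hvU, hvN⟩ := mem_filter.1 hv
      -- The neighbourhoods may be smaller than the sides by a factor α, so relative size η in a
      -- side becomes η/α in a neighbourhood. The bound α^(h+1)/(2K) on η becomes exactly α^h/(2K);
      -- `K` stays fixed throughout the induction.
      have h1 := ih (by omega) C' (fun i j hij => by simpa using hC _ _ hij) E' (N v) (η / α)
        (by positivity)
        (by rw [div_le_iff₀ hα]; refine hη.trans (le_of_eq ?_); rw [pow_succ]; ring)
        (fun i j hij A hA B hB hAc hBc => hden i.succ j.succ hij A (hA.trans (hNsub v i)) B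
          (hB.trans (hNsub v j))
          (le_trans (by
            calc η * #(U i.succ) = η / α * (α * #(U i.succ)) := by field_simp
              _ ≤ _ := by gcongr; exact hvN i) hAc)
          (le_trans (by
            calc η * #(U j.succ) = η / α * (α * #(U j.succ)) := by field_simp
              _ ≤ _ := by gcongr; exact hvN j) hBc))
      have h2 : (α ^ h / 2) ^ h * (α ^ h * ∏ j : Fin h, (#(U j.succ) : ℝ))
          ≤ (α ^ h / 2) ^ h * ∏ j, (#(N v j) : ℝ) := by
        gcongr
        exact prod_card_le_of_mul_le hα.le (fun _ => Nat.cast_nonneg _) hvN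
      refine h2.trans (h1.trans ?_)
      norm_cast
      refine card_le_card_of_injOn (fun x => (Fin.cons v x : Fin (h + 1) → W)) ?_ ?_
      · intro x hx
        obtain ⟨hx1, hx2⟩ := mem_solutions.1 hx
        simp only [mem_coe, mem_filter, Fin.cons_zero, and_true]
        refine mem_solutions.2 ⟨fun i => ?_, fun i j hij => ?_⟩
        · refine Fin.cases ?_ (fun i => ?_) i
          · simpa using hvU
          · simpa using hNsub v i (hx1 i)
        · have hlt := hC i j hij
          induction j using Fin.cases with
          | zero => exact absurd hlt (by simp)
          | succ j =>
            induction i using Fin.cases with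
            | zero =>
              have := hx1 j
              simp only [hN, hij, if_true, mem_filter] at this
              simpa using this.2
            | succ i => simpa using hx2 i j hij
      · intro x _ y _ hxy
        exact (Fin.cons_injective2 hxy).2
    have hcard : ((#(solutions C E U) : ℕ) : ℝ)
        = ∑ v ∈ U 0, (#((solutions C E U).filter fun x => x 0 = v) : ℝ) := by
      rw [card_eq_sum_card_fiberwise (f := fun x => x 0) (t := U 0)
        (fun x hx => (mem_solutions.1 hx).1 0)]
      push_cast; rfl
    rw [hcard, Fin.prod_univ_succ]
    refine (peel_bound hα hα1 (Nat.cast_nonneg _) (prod_nonneg fun _ _ => Nat.cast_nonneg _)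
      hgoodcard h).trans ?_
    rw [← nsmul_eq_mul, ← sum_const]
    exact (sum_le_sum hfib).trans
      (sum_le_sum_of_subset_of_nonneg (filter_subset _ _) fun _ _ _ => Nat.cast_nonneg _)

/-! ### Packing a box with sparse subboxes and passing to rectangles. -/

/-- The pair `(A, B)` has density at most `α` in `E`. -/
def IsSparse {W : Type*} [DecidableEq W] (E : Finset (W × W)) (α : ℝ) (A B : Finset W) : Prop :=
  (#((A ×ˢ B) ∩ E) : ℝ) ≤ α * (#A * #B)

theorem card_piFinset_le_of_small {W : Type*} {h : ℕ} {U V : Fin h → Finset W}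
    (hUV : ∀ i, U i ⊆ V i) {γ : ℝ} {i : Fin h} (hi : (#(U i) : ℝ) ≤ γ * #(V i)) :
    (#(Fintype.piFinset U) : ℝ) ≤ γ * #(Fintype.piFinset V) := by
  classical
  rw [Fintype.card_piFinset, Fintype.card_piFinset, ← mul_prod_erase univ _ (mem_univ i),
    ← mul_prod_erase univ (fun k => #(V k)) (mem_univ i)]
  push_cast
  rw [← mul_assoc]
  have : ∏ k ∈ univ.erase i, (#(U k) : ℝ) ≤ ∏ k ∈ univ.erase i, (#(V k) : ℝ) :=
    prod_le_prod (fun _ _ => by positivity) fun k _ => by exact_mod_cast card_le_card (hUV k)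
  exact mul_le_mul hi this (by positivity) (le_trans (by positivity) hi)

theorem card_piFinset_update_ge {W : Type*} {h : ℕ} (U : Fin h → Finset W)
    {η : ℝ} {i : Fin h} {A : Finset W} (hA : η * #(U i) ≤ #A) :
    η * #(Fintype.piFinset U) ≤ #(Fintype.piFinset (Function.update U i A)) := by
  classical
  rw [Fintype.card_piFinset, Fintype.card_piFinset, ← mul_prod_erase univ _ (mem_univ i),
    ← mul_prod_erase univ (fun k => #(Function.update U i A k)) (mem_univ i)]
  have : ∏ k ∈ univ.erase i, #(Function.update U i A k) = ∏ k ∈ univ.erase i, #(U k) :=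
    prod_congr rfl fun k hk => by rw [Function.update_of_ne (ne_of_mem_erase hk)]
  rw [this, Function.update_self]
  push_cast
  rw [← mul_assoc]
  gcongr

/-- If every large subbox contains a sparse pair of relatively large sides, then most of a box can
be covered by few disjoint subboxes, each with a sparse pair of sides. -/
theorem exists_sparse_boxes {W : Type*} [DecidableEq W] {h : ℕ} (𝒞 : Finset (Fin h × Fin h))
    (h𝒞 : ∀ c ∈ 𝒞, c.1 ≠ c.2) (E : Fin h → Fin h → Finset (W × W)) (V : Fin h → Finset W)
    {γ η α : ℝ} (hγ : 0 ≤ γ) (hη0 : 0 ≤ η) (hη1 : η ≤ 1)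
    (hV : ∀ U : Fin h → Finset W, (∀ i, U i ⊆ V i) → (∀ i, γ * #(V i) ≤ #(U i)) →
      ∃ c ∈ 𝒞, ∃ A ⊆ U c.1, ∃ B ⊆ U c.2, η * #(U c.1) ≤ #A ∧ η * #(U c.2) ≤ #B ∧
        IsSparse (E c.1 c.2) α A B) :
    ∀ (r : ℕ) (U : Fin h → Finset W), (∀ i, U i ⊆ V i) →
      ∃ 𝓑 : Finset (Fin h → Finset W), #𝓑 + 1 ≤ 2 ^ r ∧
        (∀ B ∈ 𝓑, (∀ i, B i ⊆ U i) ∧ ∃ c ∈ 𝒞, IsSparse (E c.1 c.2) α (B c.1) (B c.2)) ∧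
        (𝓑 : Set (Fin h → Finset W)).PairwiseDisjoint Fintype.piFinset ∧
        (1 - (1 - η ^ 2) ^ r) * #(Fintype.piFinset U) - (2 ^ r - 1) * γ * #(Fintype.piFinset V)
          ≤ #(𝓑.biUnion Fintype.piFinset) := by
  intro r
  induction r with
  | zero => intro U _; exact ⟨∅, by simp⟩
  | succ r ih =>
    intro U hU
    have hs0 : 0 ≤ 1 - η ^ 2 := by nlinarith
    have hs1 : 1 - η ^ 2 ≤ 1 := by nlinarith
    have hp0 : ∀ r, 0 ≤ (1 - η ^ 2) ^ r := fun r => pow_nonneg hs0 r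
    have hp1 : ∀ r, (1 - η ^ 2) ^ r ≤ 1 := fun r => pow_le_one₀ hs0 hs1
    -- A box with a side this short is abandoned; its volume is charged to the term in γ.
    by_cases hsmall : ∃ i, (#(U i) : ℝ) ≤ γ * #(V i)
    · obtain ⟨i, hi⟩ := hsmall
      have h1 := card_piFinset_le_of_small hU hi
      refine ⟨∅, by simpa using Nat.one_le_two_pow, by simp, by simp, ?_⟩
      have h2 : (1 : ℝ) ≤ 2 ^ r := one_le_pow₀ (by norm_num)
      have h3 : 0 ≤ γ * (#(Fintype.piFinset V) : ℝ) := by positivity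
      have h4 : 0 ≤ (#(Fintype.piFinset U) : ℝ) := by positivity
      simp only [biUnion_empty, card_empty, Nat.cast_zero, pow_succ (2 : ℝ)]
      nlinarith [mul_nonneg (hp0 (r + 1)) h4]
    push Not at hsmall
    obtain ⟨c, hc, A, hA, B, hB, hAc, hBc, hsp⟩ := hV U hU fun i => (hsmall i).le
    have hij := h𝒞 c hc
    obtain ⟨i, j⟩ := c
    simp only at hA hB hAc hBc hsp hij
    -- Keep the box `G` with sides A and B, and recurse on the disjoint boxes `X` and `Y` that cover
    -- the rest. As `G` takes a proportion η² of the volume, r levels leave (1 - η²)^r uncovered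
    -- apart from abandoned boxes, and the binary recursion keeps fewer than 2^r boxes.
    set G := Function.update (Function.update U i A) j B with hG
    set X := Function.update (Function.update U i A) j (U j \ B) with hX
    set Y := Function.update U i (U i \ A) with hY
    have hGi : G i = A := by simp [hG, Function.update_of_ne hij]
    have hGj : G j = B := by simp [hG]
    have hXi : X i = A := by simp [hX, Function.update_of_ne hij]
    have hXj : X j = U j \ B := by simp [hX]
    have hYi : Y i = U i \ A := by simp [hY]
    have hGk : ∀ k, k ≠ i → k ≠ j → G k = U k := fun k h1 h2 => by
      simp [hG, Function.update_of_ne h1, Function.update_of_ne h2]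
    have hXk : ∀ k, k ≠ i → k ≠ j → X k = U k := fun k h1 h2 => by
      simp [hX, Function.update_of_ne h1, Function.update_of_ne h2]
    have hYk : ∀ k, k ≠ i → Y k = U k := fun k h1 => by
      simp [hY, Function.update_of_ne h1]
    have hGU : ∀ k, G k ⊆ U k := fun k => by
      by_cases h1 : k = i
      · subst h1; rwa [hGi]
      by_cases h2 : k = j
      · subst h2; rwa [hGj]
      rw [hGk k h1 h2]
    have hXU : ∀ k, X k ⊆ U k := fun k => by
      by_cases h1 : k = i
      · subst h1; rwa [hXi]
      by_cases h2 : k = j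
      · subst h2; rw [hXj]; exact sdiff_subset
      rw [hXk k h1 h2]
    have hYU : ∀ k, Y k ⊆ U k := fun k => by
      by_cases h1 : k = i
      · subst h1; rw [hYi]; exact sdiff_subset
      rw [hYk k h1]
    have hGvol : η ^ 2 * (#(Fintype.piFinset U) : ℝ) ≤ #(Fintype.piFinset G) := by
      have h1 := card_piFinset_update_ge U hAc
      have h2 := card_piFinset_update_ge (Function.update U i A) (i := j) (A := B) (η := η)
        (by rwa [Function.update_of_ne hij.symm])
      nlinarith
    have hcover : (#(Fintype.piFinset U) : ℝ) ≤ #(Fintype.piFinset G) + #(Fintype.piFinset X)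
        + #(Fintype.piFinset Y) := by
      have : Fintype.piFinset U ⊆ Fintype.piFinset G ∪ Fintype.piFinset X ∪ Fintype.piFinset Y := by
        intro x hx
        rw [Fintype.mem_piFinset] at hx
        simp only [mem_union, Fintype.mem_piFinset]
        by_cases h1 : x i ∈ A
        · left
          by_cases h2 : x j ∈ B
          · left; intro k
            by_cases h3 : k = i
            · subst h3; rwa [hGi]
            by_cases h4 : k = j
            · subst h4; rwa [hGj]
            rw [hGk k h3 h4]; exact hx k
          · right; intro k
            by_cases h3 : k = i
            · subst h3; rwa [hXi]
            by_cases h4 : k = j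
            · subst h4; rw [hXj]; exact mem_sdiff.2 ⟨hx k, h2⟩
            rw [hXk k h3 h4]; exact hx k
        · right; intro k
          by_cases h3 : k = i
          · subst h3; rw [hYi]; exact mem_sdiff.2 ⟨hx k, h1⟩
          rw [hYk k h3]; exact hx k
      exact_mod_cast (card_le_card this).trans ((card_union_le _ _).trans
        (Nat.add_le_add_right (card_union_le _ _) _))
    obtain ⟨𝓑X, hXcard, hXsub, hXdisj, hXvol⟩ := ih X fun k => (hXU k).trans (hU k)
    obtain ⟨𝓑Y, hYcard, hYsub, hYdisj, hYvol⟩ := ih Y fun k => (hYU k).trans (hU k)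
    have hsubX : 𝓑X.biUnion Fintype.piFinset ⊆ Fintype.piFinset X :=
      biUnion_subset.2 fun B hB => Fintype.piFinset_subset _ _ (hXsub B hB).1
    have hsubY : 𝓑Y.biUnion Fintype.piFinset ⊆ Fintype.piFinset Y :=
      biUnion_subset.2 fun B hB => Fintype.piFinset_subset _ _ (hYsub B hB).1
    have dGX : Disjoint (Fintype.piFinset G) (Fintype.piFinset X) := by
      rw [disjoint_left]; intro x h1 h2
      have h1 := Fintype.mem_piFinset.1 h1 j
      have h2 := Fintype.mem_piFinset.1 h2 j
      rw [hGj] at h1; rw [hXj] at h2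
      exact (mem_sdiff.1 h2).2 h1
    have dGY : Disjoint (Fintype.piFinset G) (Fintype.piFinset Y) := by
      rw [disjoint_left]; intro x h1 h2
      have h1 := Fintype.mem_piFinset.1 h1 i
      have h2 := Fintype.mem_piFinset.1 h2 i
      rw [hGi] at h1; rw [hYi] at h2
      exact (mem_sdiff.1 h2).2 h1
    have dXY : Disjoint (Fintype.piFinset X) (Fintype.piFinset Y) := by
      rw [disjoint_left]; intro x h1 h2
      have h1 := Fintype.mem_piFinset.1 h1 i
      have h2 := Fintype.mem_piFinset.1 h2 i
      rw [hXi] at h1; rw [hYi] at h2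
      exact (mem_sdiff.1 h2).2 h1
    refine ⟨insert G (𝓑X ∪ 𝓑Y), ?_, ?_, ?_, ?_⟩
    · have h1 := card_insert_le G (𝓑X ∪ 𝓑Y)
      have h2 := card_union_le 𝓑X 𝓑Y
      rw [pow_succ]; omega
    · intro B' hB'
      rcases mem_insert.1 hB' with rfl | hB'
      · exact ⟨hGU, (i, j), hc, by simpa only [hGi, hGj] using hsp⟩
      · rcases mem_union.1 hB' with hB' | hB'
        · exact ⟨fun k => ((hXsub _ hB').1 k).trans (hXU k), (hXsub _ hB').2⟩
        · exact ⟨fun k => ((hYsub _ hB').1 k).trans (hYU k), (hYsub _ hB').2⟩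
    · have hsX : ∀ B ∈ 𝓑X, Fintype.piFinset B ⊆ Fintype.piFinset X := fun B hB =>
        Fintype.piFinset_subset _ _ (hXsub B hB).1
      have hsY : ∀ B ∈ 𝓑Y, Fintype.piFinset B ⊆ Fintype.piFinset Y := fun B hB =>
        Fintype.piFinset_subset _ _ (hYsub B hB).1
      rw [coe_insert, coe_union]
      refine Set.PairwiseDisjoint.insert (Set.pairwiseDisjoint_union.2 ⟨hXdisj, hYdisj, ?_⟩) ?_
      · intro B1 h1 B2 h2 _
        exact dXY.mono (hsX _ h1) (hsY _ h2)
      · intro B' h1 _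
        rcases h1 with h1 | h1
        · exact dGX.mono_right (hsX _ h1)
        · exact dGY.mono_right (hsY _ h1)
    · rw [biUnion_insert, union_biUnion, card_union_of_disjoint
        (disjoint_union_right.2 ⟨dGX.mono_right hsubX, dGY.mono_right hsubY⟩),
        card_union_of_disjoint (dXY.mono hsubX hsubY)]
      push_cast
      set s := (1 - η ^ 2) ^ r with hs
      have e1 : (1 - η ^ 2) ^ (r + 1) = s * (1 - η ^ 2) := pow_succ _ _
      rw [e1, pow_succ (2 : ℝ)]
      have h1s : 0 ≤ 1 - s := by linarith [hp1 r]
      have h3 : 0 ≤ γ * (#(Fintype.piFinset V) : ℝ) := by positivity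
      have := mul_le_mul_of_nonneg_left hcover h1s
      have := mul_le_mul_of_nonneg_left hGvol (hp0 r)
      rw [← hs] at this
      nlinarith

/-- A fibre of a disjoint family of boxes with sparse sides `i`, `j`. -/
theorem exists_sparse_fibre {W : Type*} [DecidableEq W] {h : ℕ} {i j : Fin h} (hij : i ≠ j)
    (E : Finset (W × W)) {α : ℝ} {V : Fin h → Finset W} (hV : ∀ k, (V k).Nonempty)
    (𝓑 : Finset (Fin h → Finset W)) (hsub : ∀ B ∈ 𝓑, ∀ k, B k ⊆ V k)
    (hsp : ∀ B ∈ 𝓑, IsSparse E α (B i) (B j))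
    (hdisj : (𝓑 : Set (Fin h → Finset W)).PairwiseDisjoint Fintype.piFinset) :
    ∃ 𝓡 : Finset (Finset W × Finset W), #𝓡 ≤ #𝓑 ∧
      (𝓡.biUnion fun S => S.1 ×ˢ S.2) ⊆ V i ×ˢ V j ∧
      #(V i) * #(V j) * #(𝓑.biUnion Fintype.piFinset)
        ≤ #(𝓡.biUnion fun S => S.1 ×ˢ S.2) * #(Fintype.piFinset V) ∧
      (#((𝓡.biUnion fun S => S.1 ×ˢ S.2) ∩ E) : ℝ)
        ≤ α * #(𝓡.biUnion fun S => S.1 ×ˢ S.2) := by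
  classical
  set G := 𝓑.biUnion Fintype.piFinset with hG
  have hGV : G ⊆ Fintype.piFinset V :=
    biUnion_subset.2 fun B hB => Fintype.piFinset_subset _ _ (hsub B hB)
  set upd : (Fin h → W) → W × W → (Fin h → W) := fun x p =>
    Function.update (Function.update x i p.1) j p.2 with hupd
  have upd_i : ∀ x p, upd x p i = p.1 := fun x p => by simp [hupd, Function.update_of_ne hij]
  have upd_j : ∀ x p, upd x p j = p.2 := fun x p => by simp [hupd]
  have upd_k : ∀ x p k, k ≠ i → k ≠ j → upd x p k = x k := fun x p k h1 h2 => by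
    simp [hupd, Function.update_of_ne h1, Function.update_of_ne h2]
  have upd_upd : ∀ x p, upd (upd x p) (x i, x j) = x := fun x p => by
    funext k
    by_cases h1 : k = i
    · subst h1; rw [upd_i]
    by_cases h2 : k = j
    · subst h2; rw [upd_j]
    rw [upd_k _ _ _ h1 h2, upd_k _ _ _ h1 h2]
  have upd_mem : ∀ x p (U : Fin h → Finset W), upd x p ∈ Fintype.piFinset U ↔
      p.1 ∈ U i ∧ p.2 ∈ U j ∧ ∀ k, k ≠ i → k ≠ j → x k ∈ U k := fun x p U => by
    rw [Fintype.mem_piFinset]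
    constructor
    · intro H
      refine ⟨by simpa [upd_i] using H i, by simpa [upd_j] using H j, fun k h1 h2 => ?_⟩
      simpa [upd_k _ _ _ h1 h2] using H k
    · rintro ⟨h1, h2, h3⟩ k
      by_cases h4 : k = i
      · subst h4; rwa [upd_i]
      by_cases h5 : k = j
      · subst h5; rwa [upd_j]
      rw [upd_k _ _ _ h4 h5]; exact h3 k h4 h5
  set R : (Fin h → W) → Finset (W × W) := fun x => (V i ×ˢ V j).filter fun p => upd x p ∈ G with hR
  -- Double count by exchanging the coordinates i, j of x with p: (x, p) corresponds to the updated
  -- point together with the old pair. Hence the average fibre has the same relative size as `G`.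
  have hcount : ∑ x ∈ Fintype.piFinset V, #(R x) = #(V i) * #(V j) * #G := by
    rw [← card_sigma, mul_comm, ← card_product, ← card_product]
    refine card_nbij' (fun q => (upd q.1 q.2, (q.1 i, q.1 j)))
      (fun q => ⟨upd q.1 q.2, (q.1 i, q.1 j)⟩) ?_ ?_ ?_ ?_
    · rintro ⟨x, p⟩ hq
      obtain ⟨hx, hp⟩ := mem_sigma.1 hq
      obtain ⟨hp1, hp2⟩ := mem_filter.1 hp
      have hx := Fintype.mem_piFinset.1 hx
      exact mem_product.2 ⟨hp2, mem_product.2 ⟨hx i, hx j⟩⟩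
    · rintro ⟨x, p⟩ hq
      obtain ⟨hx, hp⟩ := mem_product.1 hq
      have hxV := Fintype.mem_piFinset.1 (hGV hx)
      have hp' := mem_product.1 hp
      refine mem_sigma.2 ⟨?_, mem_filter.2 ⟨mem_product.2 ⟨hxV i, hxV j⟩, ?_⟩⟩
      · exact (upd_mem _ _ _).2 ⟨hp'.1, hp'.2, fun k _ _ => hxV k⟩
      · simpa only [upd_upd] using hx
    · rintro ⟨x, p⟩ _
      simp [upd_upd, upd_i, upd_j]
    · rintro ⟨x, p⟩ _
      simp [upd_upd, upd_i, upd_j]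
  obtain ⟨x, hx, hxle⟩ : ∃ x ∈ Fintype.piFinset V,
      #(V i) * #(V j) * #G ≤ #(R x) * #(Fintype.piFinset V) := by
    refine exists_le_of_sum_le (Fintype.piFinset_nonempty.2 hV) ?_
    rw [sum_const, ← sum_mul, hcount, smul_eq_mul, mul_comm]
  set 𝓑x := 𝓑.filter fun B => ∀ k, k ≠ i → k ≠ j → x k ∈ B k with h𝓑x
  have hRx : R x = 𝓑x.biUnion fun B => B i ×ˢ B j := by
    ext p
    simp only [hR, hG, mem_filter, mem_biUnion, mem_product, h𝓑x]
    constructor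
    · rintro ⟨-, B, hB, hp⟩
      have := (upd_mem _ _ _).1 hp
      exact ⟨B, ⟨hB, this.2.2⟩, this.1, this.2.1⟩
    · rintro ⟨B, ⟨hB, h1⟩, h2, h3⟩
      exact ⟨⟨hsub B hB i h2, hsub B hB j h3⟩, B, hB, (upd_mem _ _ _).2 ⟨h2, h3, h1⟩⟩
  have hdis : (𝓑x : Set (Fin h → Finset W)).PairwiseDisjoint fun B => B i ×ˢ B j := by
    intro B hB B' hB' hne
    have hB := mem_filter.1 hB
    have hB' := mem_filter.1 hB'
    have hd := hdisj hB.1 hB'.1 hne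
    rw [Function.onFun, disjoint_left] at hd ⊢
    intro p hp hp'
    rw [mem_product] at hp hp'
    exact hd ((upd_mem x p B).2 ⟨hp.1, hp.2, hB.2⟩) ((upd_mem x p B').2 ⟨hp'.1, hp'.2, hB'.2⟩)
  have himg : ((𝓑x.image fun B => (B i, B j)).biUnion fun S => S.1 ×ˢ S.2) = R x := by
    rw [hRx, image_biUnion]
  refine ⟨𝓑x.image fun B => (B i, B j), card_image_le.trans (card_filter_le _ _), ?_⟩
  rw [himg]
  refine ⟨filter_subset _ _, hxle, ?_⟩
  rw [hRx, biUnion_inter, card_biUnion hdis, card_biUnion fun B hB B' hB' hne =>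
    (hdis hB hB' hne).mono inter_subset_left inter_subset_left]
  push_cast
  rw [mul_sum]
  refine sum_le_sum fun B hB => ?_
  have := hsp B (mem_filter.1 hB).1
  rw [IsSparse] at this
  rw [card_product]
  push_cast
  exact this

/-- If every large subbox contains a sparse pair of relatively large sides, then for one of the
constraints a positive proportion of the corresponding two-dimensional face is covered by a union
of few rectangles that is sparse. -/
theorem exists_sparse_rectangles {W : Type*} [DecidableEq W] {h : ℕ} (𝒞 : Finset (Fin h × Fin h))
    (h𝒞 : ∀ c ∈ 𝒞, c.1 ≠ c.2) (E : Fin h → Fin h → Finset (W × W)) (V : Fin h → Finset W)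
    (hVne : ∀ i, (V i).Nonempty)
    {γ η α : ℝ} (hγ : 0 ≤ γ) (hη0 : 0 ≤ η) (hη1 : η ≤ 1)
    (hV : ∀ U : Fin h → Finset W, (∀ i, U i ⊆ V i) → (∀ i, γ * #(V i) ≤ #(U i)) →
      ∃ c ∈ 𝒞, ∃ A ⊆ U c.1, ∃ B ⊆ U c.2, η * #(U c.1) ≤ #A ∧ η * #(U c.2) ≤ #B ∧
        IsSparse (E c.1 c.2) α A B) (r : ℕ) (hr : (1 - η ^ 2) ^ r ≤ 1 / 4)
    (hγr : 2 ^ r * γ ≤ 1 / 4) :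
    ∃ c ∈ 𝒞, ∃ 𝓡 : Finset (Finset W × Finset W), #𝓡 ≤ 2 ^ r ∧
      (𝓡.biUnion fun S => S.1 ×ˢ S.2) ⊆ V c.1 ×ˢ V c.2 ∧
      (#(V c.1) * #(V c.2) : ℝ) ≤ 2 * #𝒞 * #(𝓡.biUnion fun S => S.1 ×ˢ S.2) ∧
      (#((𝓡.biUnion fun S => S.1 ×ˢ S.2) ∩ E c.1 c.2) : ℝ)
        ≤ α * #(𝓡.biUnion fun S => S.1 ×ˢ S.2) := by
  classical
  obtain ⟨𝓑, hcard, hsub, hdisj, hvol⟩ := exists_sparse_boxes 𝒞 h𝒞 E V hγ hη0 hη1 hV r V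
    fun _ => subset_rfl
  set v : ℝ := ((#(Fintype.piFinset V) : ℕ) : ℝ) with hv
  have hv0 : 0 < v := by
    rw [hv]; exact_mod_cast card_pos.2 (Fintype.piFinset_nonempty.2 hVne)
  -- At most a quarter of the volume is left by the recursion and at most a quarter is abandoned.
  have hhalf : v / 2 ≤ #(𝓑.biUnion Fintype.piFinset) := by
    refine le_trans ?_ hvol
    have h1 : (1 - η ^ 2) ^ r * v ≤ 1 / 4 * v := by gcongr
    have h2 : 2 ^ r * γ * v ≤ 1 / 4 * v := by gcongr
    have h3 : 0 ≤ γ * v := by positivity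
    nlinarith
  set 𝓑c : Fin h × Fin h → Finset (Fin h → Finset W) := fun c =>
    𝓑.filter fun B => IsSparse (E c.1 c.2) α (B c.1) (B c.2) with h𝓑c
  have hsum : v / 2 ≤ ∑ c ∈ 𝒞, (#((𝓑c c).biUnion Fintype.piFinset) : ℝ) := by
    refine hhalf.trans ?_
    have : 𝓑.biUnion Fintype.piFinset ⊆ 𝒞.biUnion fun c => (𝓑c c).biUnion Fintype.piFinset := by
      intro x hx
      obtain ⟨B, hB, hxB⟩ := mem_biUnion.1 hx
      obtain ⟨-, c, hc, hsp⟩ := hsub B hB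
      exact mem_biUnion.2 ⟨c, hc, mem_biUnion.2 ⟨B, mem_filter.2 ⟨hB, hsp⟩, hxB⟩⟩
    exact_mod_cast (card_le_card this).trans card_biUnion_le
  obtain ⟨c, hc, hcle⟩ : ∃ c ∈ 𝒞, v ≤ 2 * #𝒞 * #((𝓑c c).biUnion Fintype.piFinset) := by
    by_contra hcon
    push Not at hcon
    rcases 𝒞.eq_empty_or_nonempty with rfl | hne
    · simp at hsum; linarith
    have h1 : ∑ c ∈ 𝒞, 2 * (#𝒞 : ℝ) * #((𝓑c c).biUnion Fintype.piFinset) < ∑ c ∈ 𝒞, v :=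
      sum_lt_sum_of_nonempty hne hcon
    rw [← mul_sum, sum_const, nsmul_eq_mul] at h1
    have h2 : (0 : ℝ) < #𝒞 := by exact_mod_cast card_pos.2 hne
    nlinarith
  obtain ⟨𝓡, h1, h2, h3, h4⟩ := exists_sparse_fibre (h𝒞 c hc) (E c.1 c.2) hVne (𝓑c c)
    (fun B hB => (hsub B (mem_filter.1 hB).1).1) (fun B hB => (mem_filter.1 hB).2)
    (hdisj.subset (filter_subset _ _))
  refine ⟨c, hc, 𝓡, h1.trans ((card_filter_le _ _).trans (by omega)), h2, ?_, h4⟩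
  have h3' : (#(V c.1) * #(V c.2) : ℝ) * #((𝓑c c).biUnion Fintype.piFinset)
      ≤ #(𝓡.biUnion fun S => S.1 ×ˢ S.2) * v := by rw [hv]; exact_mod_cast h3
  have hg : (0 : ℝ) < #((𝓑c c).biUnion Fintype.piFinset) := by
    by_contra hcon
    have : (#((𝓑c c).biUnion Fintype.piFinset) : ℝ) = 0 := le_antisymm (not_lt.1 hcon) (by positivity)
    rw [this] at hcle; linarith
  set g : ℝ := ((#((𝓑c c).biUnion Fintype.piFinset) : ℕ) : ℝ)
  have h5 : (#(𝓡.biUnion fun S => S.1 ×ˢ S.2) : ℝ) * v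
      ≤ #(𝓡.biUnion fun S => S.1 ×ˢ S.2) * (2 * #𝒞 * g) := by gcongr
  refine le_of_mul_le_mul_right ?_ hg
  linarith

/-- A proportion at least `1 / K` of `A × B` is covered by a union of at most `N` rectangles
on which `E` has density at most `α`. -/
def IsShattered {W : Type*} [DecidableEq W] (E : Finset (W × W)) (α K : ℝ) (N : ℕ)
    (A B : Finset W) : Prop :=
  ∃ 𝓡 : Finset (Finset W × Finset W), #𝓡 ≤ N ∧ (𝓡.biUnion fun S => S.1 ×ˢ S.2) ⊆ A ×ˢ B ∧
    (#A * #B : ℝ) ≤ K * #(𝓡.biUnion fun S => S.1 ×ˢ S.2) ∧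
    (#((𝓡.biUnion fun S => S.1 ×ˢ S.2) ∩ E) : ℝ) ≤ α * #(𝓡.biUnion fun S => S.1 ×ˢ S.2)

/-- A subbox with sides at least γ|V i| and no sparse pair of sides would by itself contain, by
`card_solutions_ge`, more solutions than `hfew` allows. So every large subbox has a sparse pair, as
`exists_sparse_rectangles` requires. -/
theorem exists_isShattered_of_few_solutions {W : Type*} [Fintype W] [DecidableEq W] {h : ℕ}
    (hh : 0 < h) (𝒞 : Finset (Fin h × Fin h)) (h𝒞 : ∀ c ∈ 𝒞, c.1 < c.2)
    (E : Fin h → Fin h → Finset (W × W)) (V : Fin h → Finset W) {θ γ α : ℝ} (hθ : 0 < θ)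
    (hVθ : ∀ i, θ ≤ #(V i)) (hγ : 0 ≤ γ) (hα : 0 < α) (hα1 : α ≤ 1) (r : ℕ)
    (hr : (1 - (α ^ h / (2 * h)) ^ 2) ^ r ≤ 1 / 4) (hγr : 2 ^ r * γ ≤ 1 / 4)
    (hfew : (#(solutions (fun i j => (i, j) ∈ 𝒞) E fun _ => univ) : ℝ)
      < (α ^ h / 2) ^ h * (γ * θ) ^ h) :
    ∃ c ∈ 𝒞, IsShattered (E c.1 c.2) α (2 * #𝒞) (2 ^ r) (V c.1) (V c.2) := by
  classical
  have hhr : (1 : ℝ) ≤ h := by exact_mod_cast hh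
  have hη0 : 0 ≤ α ^ h / (2 * h) := by positivity
  have hη1 : α ^ h / (2 * h) ≤ 1 := by
    rw [div_le_one (by positivity)]
    have := pow_le_one₀ (n := h) hα.le hα1
    linarith
  refine exists_sparse_rectangles 𝒞 (fun c hc => (h𝒞 c hc).ne) E V
    (fun i => card_pos.1 (by exact_mod_cast hθ.trans_le (hVθ i))) hγ hη0 hη1 ?_ r hr hγr
  by_contra hcon
  push Not at hcon
  obtain ⟨U, -, hU, hden⟩ := hcon
  have h1 := card_solutions_ge hα hα1 h hh h le_rfl (fun i j => (i, j) ∈ 𝒞)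
    (fun i j hij => h𝒞 _ hij) E U _ hη0 le_rfl
    (fun i j hij A hA B hB hA' hB' => hden (i, j) hij A hA B hB hA' hB')
  have h2 : (γ * θ) ^ h ≤ ∏ i, (#(U i) : ℝ) := by
    have := prod_card_le_of_mul_le (α := γ) (f := fun _ : Fin h => θ) (g := fun i => (#(U i) : ℝ))
      hγ (fun _ => hθ.le) (fun i => (mul_le_mul_of_nonneg_left (hVθ i) hγ).trans (hU i))
    simpa [mul_pow] using this
  have h3 : #(solutions (fun i j => (i, j) ∈ 𝒞) E U)
      ≤ #(solutions (fun i j => (i, j) ∈ 𝒞) E fun _ => univ) :=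
    card_le_card fun x hx => mem_solutions.2 ⟨fun _ => mem_univ _, (mem_solutions.1 hx).2⟩
  have h3' : (#(solutions (fun i j => (i, j) ∈ 𝒞) E U) : ℝ)
      ≤ #(solutions (fun i j => (i, j) ∈ 𝒞) E fun _ => univ) := by exact_mod_cast h3
  have h4 : (α ^ h / 2) ^ h * (γ * θ) ^ h ≤ (α ^ h / 2) ^ h * ∏ i, (#(U i) : ℝ) := by gcongr
  linarith

/-! ### Partitions generated by sets, and the entropy gained by resolving rectangles. -/

/-- The colour of `x` in the partition generated by the sets in `𝓐`. -/
def atom {W : Type*} [DecidableEq W] (𝓐 : Finset (Finset W)) (x : W) : Finset (Finset W) :=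
  𝓐.filter fun A => x ∈ A

theorem mem_iff_of_atom_eq {W : Type*} [DecidableEq W] {𝓐 : Finset (Finset W)} {x y : W}
    (h : atom 𝓐 x = atom 𝓐 y) {A : Finset W} (hA : A ∈ 𝓐) : x ∈ A ↔ y ∈ A := by
  have := congrArg (A ∈ ·) h
  simpa [atom, hA] using this

theorem atom_eq_of_subset {W : Type*} [DecidableEq W] {𝓐 𝓐' : Finset (Finset W)} (h𝓐 : 𝓐 ⊆ 𝓐')
    {x y : W} (h : atom 𝓐' x = atom 𝓐' y) : atom 𝓐 x = atom 𝓐 y := by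
  ext A
  simp only [atom, mem_filter]
  exact and_congr_right fun hA => mem_iff_of_atom_eq h (h𝓐 hA)

/-- The set of points of a given colour. -/
def cell {W : Type*} [Fintype W] [DecidableEq W] (𝓐 : Finset (Finset W)) (s : Finset (Finset W)) :
    Finset W :=
  univ.filter fun x => atom 𝓐 x = s

theorem mem_cell {W : Type*} [Fintype W] [DecidableEq W] {𝓐 s : Finset (Finset W)} {x : W} :
    x ∈ cell 𝓐 s ↔ atom 𝓐 x = s := by simp [cell]

/-- The colour of a pair. -/
def pairAtom {W : Type*} [DecidableEq W] (𝓐 : Finset (Finset W)) (p : W × W) :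
    Finset (Finset W) × Finset (Finset W) :=
  (atom 𝓐 p.1, atom 𝓐 p.2)

/-- The indicator function of a finite set. -/
def ind {Ω : Type*} [DecidableEq Ω] (E : Finset Ω) (ω : Ω) : ℝ := if ω ∈ E then 1 else 0

theorem ind_nonneg {Ω : Type*} [DecidableEq Ω] (E : Finset Ω) (ω : Ω) : 0 ≤ ind E ω := by
  unfold ind; split_ifs <;> norm_num

theorem ind_le_one {Ω : Type*} [DecidableEq Ω] (E : Finset Ω) (ω : Ω) : ind E ω ≤ 1 := by
  unfold ind; split_ifs <;> norm_num

theorem sum_ind {Ω : Type*} [DecidableEq Ω] (E R : Finset Ω) : ∑ ω ∈ R, ind E ω = #(R ∩ E) := by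
  simp [ind, sum_ite_mem]

theorem condAvg_pairAtom {W : Type*} [Fintype W] [DecidableEq W] (𝓐 : Finset (Finset W))
    (E : Finset (W × W)) {ω : W × W} {st : Finset (Finset W) × Finset (Finset W)}
    (hω : pairAtom 𝓐 ω = st) :
    condAvg (pairAtom 𝓐) (ind E) ω
      = #((cell 𝓐 st.1 ×ˢ cell 𝓐 st.2) ∩ E) / (#(cell 𝓐 st.1) * #(cell 𝓐 st.2)) := by
  have : (univ.filter fun ω' => pairAtom 𝓐 ω' = pairAtom 𝓐 ω)
      = cell 𝓐 st.1 ×ˢ cell 𝓐 st.2 := by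
    ext ω'
    subst hω
    simp [mem_cell, pairAtom]
  rw [condAvg, this, sum_ind, card_product, Nat.cast_mul]

/-- Refining the partition so that shattered pairs of cells are resolved raises the entropy. -/
theorem entropy_increment_of_isShattered {W : Type*} [Fintype W] [DecidableEq W]
    (𝓐 : Finset (Finset W)) (E : Finset (W × W)) {α K : ℝ} (hα : 0 ≤ α) (hK : 0 < K) {N : ℕ}
    (𝓢 : Finset (Finset (Finset W) × Finset (Finset W)))
    (h𝓢 : ∀ st ∈ 𝓢, IsShattered E α K N (cell 𝓐 st.1) (cell 𝓐 st.2))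
    (hdense : ∀ st ∈ 𝓢, 2 * α * (#(cell 𝓐 st.1) * #(cell 𝓐 st.2))
      ≤ #((cell 𝓐 st.1 ×ˢ cell 𝓐 st.2) ∩ E)) :
    ∃ 𝓣 : Finset (Finset W), #𝓣 ≤ 2 * N * #𝓢 ∧ ∀ 𝓐', 𝓐 ⊆ 𝓐' → 𝓣 ⊆ 𝓐' →
      entropy (pairAtom 𝓐) (ind E) + 3 / (20 * K) * #(E.filter fun ω => pairAtom 𝓐 ω ∈ 𝓢)
        ≤ entropy (pairAtom 𝓐') (ind E) := by
  classical
  choose! 𝓡 h1 h2 h3 h4 using h𝓢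
  set Q : Finset (Finset W) × Finset (Finset W) → Finset (W × W) := fun st =>
    (𝓡 st).biUnion fun S => S.1 ×ˢ S.2 with hQ
  -- The new generators are the sides of the rectangles, which makes each `Q st` a union of pairs of
  -- new cells. Allowing any larger `𝓐'` lets all constraints share one refinement later.
  refine ⟨𝓢.biUnion fun st => (𝓡 st).image Prod.fst ∪ (𝓡 st).image Prod.snd, ?_, ?_⟩
  · calc _ ≤ ∑ st ∈ 𝓢, #((𝓡 st).image Prod.fst ∪ (𝓡 st).image Prod.snd) := card_biUnion_le
      _ ≤ ∑ st ∈ 𝓢, 2 * N := sum_le_sum fun st hst => by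
        have e1 := card_union_le ((𝓡 st).image Prod.fst) ((𝓡 st).image Prod.snd)
        have e2 := card_image_le (s := 𝓡 st) (f := Prod.fst)
        have e3 := card_image_le (s := 𝓡 st) (f := Prod.snd)
        have e4 := h1 st hst
        omega
      _ = _ := by rw [sum_const, smul_eq_mul, mul_comm]
  intro 𝓐' h𝓐 h𝓣
  have hpa : ∀ st ∈ 𝓢, ∀ ω ∈ Q st, pairAtom 𝓐 ω = st := fun st hst ω hω => by
    have := mem_product.1 (h2 st hst hω)
    rw [mem_cell, mem_cell] at this
    exact Prod.ext this.1 this.2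
  refine le_trans ?_ (entropy_increment (pairAtom 𝓐) (pairAtom 𝓐') (ind_nonneg E) ?_ (𝓢.biUnion Q) ?_)
  · refine add_le_add_right ?_ _
    rw [sum_biUnion]
    · have hc : #(E.filter fun ω => pairAtom 𝓐 ω ∈ 𝓢)
          = ∑ st ∈ 𝓢, #((cell 𝓐 st.1 ×ˢ cell 𝓐 st.2) ∩ E) := by
        have hmaps : ∀ ω ∈ E.filter (fun ω => pairAtom 𝓐 ω ∈ 𝓢), pairAtom 𝓐 ω ∈ 𝓢 :=
          fun ω hω => (mem_filter.1 hω).2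
        rw [card_eq_sum_card_fiberwise (f := pairAtom 𝓐) (t := 𝓢) hmaps]
        refine sum_congr rfl fun st hst => congrArg card ?_
        ext ω
        simp only [mem_filter, mem_inter, mem_product, mem_cell]
        constructor
        · rintro ⟨⟨hE, -⟩, rfl⟩; exact ⟨⟨rfl, rfl⟩, hE⟩
        · rintro ⟨⟨e1, e2⟩, hE⟩
          have : pairAtom 𝓐 ω = st := Prod.ext e1 e2
          exact ⟨⟨hE, this ▸ hst⟩, this⟩
      rw [hc, Nat.cast_sum, mul_sum]
      refine sum_le_sum fun st hst => ?_
      rw [sum_sub_distrib, ← sum_mul, sum_ind,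
        sum_congr rfl fun ω hω => congrArg (· / (2 : ℝ)) (condAvg_pairAtom 𝓐 E (hpa st hst ω hω)),
        sum_const, nsmul_eq_mul]
      have h3 := h3 st hst
      have h4 := h4 st hst
      have hd := hdense st hst
      have hle : #((cell 𝓐 st.1 ×ˢ cell 𝓐 st.2) ∩ E) ≤ #(cell 𝓐 st.1) * #(cell 𝓐 st.2) := by
        rw [← card_product]; exact card_le_card inter_subset_left
      have hle' : (#((cell 𝓐 st.1 ×ˢ cell 𝓐 st.2) ∩ E) : ℝ)
        ≤ #(cell 𝓐 st.1) * #(cell 𝓐 st.2) := by exact_mod_cast hle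
      have hq : #(Q st) ≤ #(cell 𝓐 st.1) * #(cell 𝓐 st.2) := by
        rw [← card_product]; exact card_le_card (h2 st hst)
      have hq' : (#(Q st) : ℝ) ≤ #(cell 𝓐 st.1) * #(cell 𝓐 st.2) := by exact_mod_cast hq
      have he0 : (0 : ℝ) ≤ #((cell 𝓐 st.1 ×ˢ cell 𝓐 st.2) ∩ E) := Nat.cast_nonneg _
      have hq0 : (0 : ℝ) ≤ #(Q st) := Nat.cast_nonneg _
      have hv0 : (0 : ℝ) ≤ #(cell 𝓐 st.1) * #(cell 𝓐 st.2) :=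
        mul_nonneg (Nat.cast_nonneg _) (Nat.cast_nonneg _)
      have hqE0 : (0 : ℝ) ≤ #(Q st ∩ E) := Nat.cast_nonneg _
      have hlog := Real.log_two_lt_d9
      change (#(cell 𝓐 st.1) * #(cell 𝓐 st.2) : ℝ) ≤ K * #(Q st) at h3
      change (#(Q st ∩ E) : ℝ) ≤ α * #(Q st) at h4
      generalize (#((cell 𝓐 st.1 ×ˢ cell 𝓐 st.2) ∩ E) : ℝ) = e at *
      generalize (#(cell 𝓐 st.1) * #(cell 𝓐 st.2) : ℝ) = v at *
      generalize (#(Q st ∩ E) : ℝ) = f at *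
      generalize (#(Q st) : ℝ) = q at *
      rcases hv0.eq_or_lt with rfl | hv
      · have : e = 0 := le_antisymm hle' he0
        have : q = 0 := le_antisymm hq' hq0
        subst_vars
        simp at h4
        nlinarith
      · have hρ : 2 * α ≤ e / v := by rwa [le_div_iff₀ hv]
        have e1 : e / K ≤ q * (e / v) := by
          rw [div_le_iff₀ hK]
          calc e = v * (e / v) := by field_simp
            _ ≤ K * q * (e / v) := by gcongr
            _ = _ := by ring
        -- With d = e/v ≥ 2α, the loss f log 2 is at most 0.7 · qd/2, so the gain qd/2 - f log 2 is
        -- at least 3qd/20 ≥ 3e/(20K).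
        have e2 : f * Real.log 2 ≤ (α * q) * (7 / 10) := by
          have : Real.log 2 ≤ 7 / 10 := by linarith
          have h0 := Real.log_nonneg (x := 2) (by norm_num)
          gcongr
        have e3 : α * q ≤ q * (e / v) / 2 := by nlinarith
        have e4 : 3 / (20 * K) * e = 3 / 20 * (e / K) := by field_simp
        have e5 : q * (e / v / 2) = q * (e / v) / 2 := by ring
        rw [e4, e5]
        linarith
    · intro st hst st' hst' hne
      rw [Function.onFun, disjoint_left]
      intro ω hω hω'
      exact hne ((hpa st hst ω hω).symm.trans (hpa st' hst' ω hω'))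
  · intro ω ω' hωω'
    have := Prod.ext_iff.1 hωω'
    exact Prod.ext (atom_eq_of_subset h𝓐 this.1) (atom_eq_of_subset h𝓐 this.2)
  · intro ω ω' hωω' hω
    obtain ⟨st, hst, hω⟩ := mem_biUnion.1 hω
    obtain ⟨S, hS, hω⟩ := mem_biUnion.1 hω
    have hω := mem_product.1 hω
    have := Prod.ext_iff.1 hωω'
    refine mem_biUnion.2 ⟨st, hst, mem_biUnion.2 ⟨S, hS, mem_product.2 ⟨?_, ?_⟩⟩⟩
    · exact (mem_iff_of_atom_eq this.1 (h𝓣 (mem_biUnion.2 ⟨st, hst, mem_union_left _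
        (mem_image_of_mem _ hS)⟩))).1 hω.1
    · exact (mem_iff_of_atom_eq this.2 (h𝓣 (mem_biUnion.2 ⟨st, hst, mem_union_right _
        (mem_image_of_mem _ hS)⟩))).1 hω.2

/-- Few points lie in small cells. -/
theorem card_small_le {W : Type*} [Fintype W] [DecidableEq W] (𝓐 : Finset (Finset W)) {θ : ℝ}
    (hθ : 0 ≤ θ) :
    (#(univ.filter fun x : W => (#(cell 𝓐 (atom 𝓐 x)) : ℝ) < θ) : ℝ) ≤ 2 ^ #𝓐 * θ := by
  classical
  have hmaps : ∀ x ∈ univ.filter (fun x : W => (#(cell 𝓐 (atom 𝓐 x)) : ℝ) < θ),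
      atom 𝓐 x ∈ 𝓐.powerset := fun x _ => mem_powerset.2 (filter_subset _ _)
  rw [card_eq_sum_card_fiberwise (f := atom 𝓐) (t := 𝓐.powerset) hmaps, Nat.cast_sum,
    ← Nat.cast_ofNat (R := ℝ), ← Nat.cast_pow, ← card_powerset, ← nsmul_eq_mul, ← sum_const]
  refine sum_le_sum fun s _ => ?_
  by_cases hs : (#(cell 𝓐 s) : ℝ) < θ
  · refine le_trans ?_ hs.le
    exact_mod_cast card_le_card fun x hx => mem_cell.2 (mem_filter.1 hx).2
  · rw [card_eq_zero.2, Nat.cast_zero]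
    · exact hθ
    · refine filter_eq_empty_iff.2 fun x hx hxs => hs ?_
      rw [← hxs]; exact (mem_filter.1 hx).2

theorem card_pairs_small_le {W : Type*} [Fintype W] [DecidableEq W] (S : Finset W) :
    #(univ.filter fun ω : W × W => ω.1 ∈ S ∨ ω.2 ∈ S) ≤ 2 * (Fintype.card W * #S) := by
  have : (univ.filter fun ω : W × W => ω.1 ∈ S ∨ ω.2 ∈ S) ⊆ S ×ˢ univ ∪ univ ×ˢ S := by
    intro ω hω
    simpa using hω
  refine (card_le_card this).trans ((card_union_le _ _).trans ?_)
  rw [card_product, card_product, card_univ]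
  exact le_of_eq (by ring)

/-- Few edges lie in sparse pairs of cells. -/
theorem card_sparse_le {Ω κ : Type*} [Fintype Ω] [DecidableEq Ω] [DecidableEq κ] (P : Ω → κ)
    (E : Finset Ω) {β : ℝ} (hβ : 0 ≤ β) :
    (#(E.filter fun ω => condAvg P (ind E) ω < β) : ℝ) ≤ β * Fintype.card Ω := by
  classical
  have h1 := sum_condAvg P (ind E) (univ.filter fun ω => condAvg P (ind E) ω < β)
    (fun ω ω' h hω => by
      rw [mem_filter] at hω ⊢
      exact ⟨mem_univ _, by rw [← condAvg_congr _ h]; exact hω.2⟩)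
  have h2 : (univ.filter fun ω => condAvg P (ind E) ω < β) ∩ E
      = E.filter fun ω => condAvg P (ind E) ω < β := by ext ω; simp [and_comm]
  rw [sum_ind, h2] at h1
  rw [← h1]
  calc _ ≤ ∑ ω ∈ univ.filter (fun ω => condAvg P (ind E) ω < β), β :=
        sum_le_sum fun ω hω => (mem_filter.1 hω).2.le
    _ = #(univ.filter fun ω => condAvg P (ind E) ω < β) * β := by rw [sum_const, nsmul_eq_mul]
    _ ≤ Fintype.card Ω * β := by gcongr; exact card_le_univ _
    _ = _ := mul_comm _ _

/-! ### The refinement step, its iteration, and removal for binary constraints. -/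

/-- One refinement step: as long as there are few solutions, a partition can be refined so that
the total entropy rises by a fixed proportion of the number of edges. -/
theorem exists_refinement {W : Type*} [Fintype W] [DecidableEq W] {h : ℕ} (hh : 0 < h)
    (𝒞 : Finset (Fin h × Fin h)) (hne : 𝒞.Nonempty) (h𝒞 : ∀ c ∈ 𝒞, c.1 < c.2)
    (F : Finset (Fin h → W)) (hF : F.Nonempty) (E : Fin h → Fin h → Finset (W × W))
    (hE : ∀ c ∈ 𝒞, ∀ x ∈ F, (x c.1, x c.2) ∈ E c.1 c.2)
    (hinj : ∀ c ∈ 𝒞, Set.InjOn (fun x : Fin h → W => (x c.1, x c.2)) F)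
    {α γ : ℝ} (hα : α = #F / (8 * #𝒞 * (Fintype.card W : ℝ) ^ 2)) (hα1 : α ≤ 1) (hγ : 0 ≤ γ)
    (r : ℕ) (hr : (1 - (α ^ h / (2 * h)) ^ 2) ^ r ≤ 1 / 4) (hγr : 2 ^ r * γ ≤ 1 / 4)
    (𝓐 : Finset (Finset W))
    (hfew : (#(solutions (fun i j => (i, j) ∈ 𝒞) E fun _ => univ) : ℝ)
      < (α ^ h / 2) ^ h * (γ * (α * Fintype.card W / 2 ^ #𝓐)) ^ h) :
    ∃ 𝓐' : Finset (Finset W), #𝓐' ≤ #𝓐 + #𝒞 * (2 * 2 ^ r * 4 ^ #𝓐) ∧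
      ∑ c ∈ 𝒞, entropy (pairAtom 𝓐) (ind (E c.1 c.2)) + #F / (32 * #𝒞)
        ≤ ∑ c ∈ 𝒞, entropy (pairAtom 𝓐') (ind (E c.1 c.2)) := by
  classical
  set n : ℝ := ((Fintype.card W : ℕ) : ℝ) with hn
  set m : ℝ := ((#𝒞 : ℕ) : ℝ) with hm
  obtain ⟨x₀, hx₀⟩ := hF
  have hn0 : 0 < n := by
    rw [hn]; exact_mod_cast Fintype.card_pos_iff.2 ⟨x₀ ⟨0, hh⟩⟩
  have hm0 : 0 < m := by rw [hm]; exact_mod_cast card_pos.2 hne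
  have hF0 : (0 : ℝ) < #F := by exact_mod_cast card_pos.2 ⟨x₀, hx₀⟩
  have hα0 : 0 < α := by rw [hα]; positivity
  -- There are at most 2^#𝓐 cells, so cells smaller than θ contain at most αn points in total.
  set θ := α * n / 2 ^ #𝓐 with hθ
  have hθ0 : 0 < θ := by positivity
  have hθn : θ ≤ n := by
    rw [hθ, div_le_iff₀ (by positivity)]
    have : (1 : ℝ) ≤ 2 ^ #𝓐 := one_le_pow₀ (by norm_num)
    nlinarith
  set 𝓢 : Fin h × Fin h → Finset (Finset (Finset W) × Finset (Finset W)) := fun c =>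
    (𝓐.powerset ×ˢ 𝓐.powerset).filter fun st =>
      IsShattered (E c.1 c.2) α (2 * m) (2 ^ r) (cell 𝓐 st.1) (cell 𝓐 st.2) ∧
      2 * α * (#(cell 𝓐 st.1) * #(cell 𝓐 st.2))
        ≤ #((cell 𝓐 st.1 ×ˢ cell 𝓐 st.2) ∩ E c.1 c.2) with h𝓢
  set S := univ.filter (fun x : W => (#(cell 𝓐 (atom 𝓐 x)) : ℝ) < θ) with hS
  have hSn : (#S : ℝ) ≤ α * n := by
    refine (card_small_le 𝓐 hθ0.le).trans (le_of_eq ?_)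
    rw [hθ]; field_simp
  have hbad : ∀ x ∈ F, ∃ c ∈ 𝒞, (x c.1, x c.2) ∈ (univ.filter fun ω : W × W => ω.1 ∈ S ∨ ω.2 ∈ S)
      ∪ ((E c.1 c.2).filter (fun ω => condAvg (pairAtom 𝓐) (ind (E c.1 c.2)) ω < 2 * α)
        ∪ (E c.1 c.2).filter fun ω => pairAtom 𝓐 ω ∈ 𝓢 c) := by
    intro x hx
    by_contra hcon
    push Not at hcon
    -- A coordinate in no constraint has no guarantee that its cell is large; it is left free.
    set V : Fin h → Finset W := fun i =>
      if ∃ c ∈ 𝒞, c.1 = i ∨ c.2 = i then cell 𝓐 (atom 𝓐 (x i)) else univ with hV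
    have hV1 : ∀ c ∈ 𝒞, V c.1 = cell 𝓐 (atom 𝓐 (x c.1)) := fun c hc =>
      if_pos ⟨c, hc, Or.inl rfl⟩
    have hV2 : ∀ c ∈ 𝒞, V c.2 = cell 𝓐 (atom 𝓐 (x c.2)) := fun c hc =>
      if_pos ⟨c, hc, Or.inr rfl⟩
    have hVθ : ∀ i, θ ≤ #(V i) := by
      intro i
      by_cases hi : ∃ c ∈ 𝒞, c.1 = i ∨ c.2 = i
      · obtain ⟨c, hc, hci⟩ := hi
        have h1 := hcon c hc
        simp only [mem_union, mem_filter, mem_univ, true_and, not_or, hS, not_lt] at h1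
        rcases hci with rfl | rfl
        · rw [hV1 c hc]; exact h1.1.1
        · rw [hV2 c hc]; exact h1.1.2
      · simp only [hV, if_neg hi, card_univ]; exact hθn
    obtain ⟨c, hc, hsh⟩ := exists_isShattered_of_few_solutions hh 𝒞 h𝒞 E V hθ0 hVθ hγ hα0 hα1 r hr
      hγr hfew
    rw [hV1 c hc, hV2 c hc] at hsh
    have h1 := hcon c hc
    simp only [mem_union, not_or] at h1
    obtain ⟨-, h2, h3⟩ := h1
    refine h3 (mem_filter.2 ⟨hE c hc x hx, mem_filter.2 ⟨mem_product.2
      ⟨mem_powerset.2 (filter_subset _ _), mem_powerset.2 (filter_subset _ _)⟩, hsh, ?_⟩⟩)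
    have h4 : 2 * α ≤ condAvg (pairAtom 𝓐) (ind (E c.1 c.2)) (x c.1, x c.2) := by
      by_contra h5
      exact h2 (mem_filter.2 ⟨hE c hc x hx, not_le.1 h5⟩)
    rw [condAvg_pairAtom 𝓐 (E c.1 c.2) rfl, le_div_iff₀] at h4
    · exact h4
    · have h5 : 0 < #(cell 𝓐 (pairAtom 𝓐 (x c.1, x c.2)).1) :=
        card_pos.2 ⟨x c.1, mem_cell.2 rfl⟩
      have h6 : 0 < #(cell 𝓐 (pairAtom 𝓐 (x c.1, x c.2)).2) :=
        card_pos.2 ⟨x c.2, mem_cell.2 rfl⟩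
      exact_mod_cast Nat.mul_pos h5 h6
  set act : Fin h × Fin h → ℝ := fun c =>
    ((#((E c.1 c.2).filter fun ω => pairAtom 𝓐 ω ∈ 𝓢 c) : ℕ) : ℝ) with hact
  -- Members of F have distinct pairs at each constraint, so pairs can be counted instead. Small
  -- cells and sparse pairs of cells account for 2αn² each per constraint, in total 4mαn² = |F|/2 by
  -- the choice of α.
  have hhalf : (#F : ℝ) / 2 ≤ ∑ c ∈ 𝒞, act c := by
    set B : Fin h × Fin h → Finset (W × W) := fun c =>
      (univ.filter fun ω : W × W => ω.1 ∈ S ∨ ω.2 ∈ S)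
      ∪ ((E c.1 c.2).filter (fun ω => condAvg (pairAtom 𝓐) (ind (E c.1 c.2)) ω < 2 * α)
        ∪ (E c.1 c.2).filter fun ω => pairAtom 𝓐 ω ∈ 𝓢 c) with hB
    have h1 : #F ≤ ∑ c ∈ 𝒞, #(B c) := by
      calc #F ≤ #(𝒞.biUnion fun c => F.filter fun x => (x c.1, x c.2) ∈ B c) :=
            card_le_card fun x hx => by
              obtain ⟨c, hc, hxc⟩ := hbad x hx
              exact mem_biUnion.2 ⟨c, hc, mem_filter.2 ⟨hx, hxc⟩⟩
        _ ≤ ∑ c ∈ 𝒞, #(F.filter fun x => (x c.1, x c.2) ∈ B c) := card_biUnion_le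
        _ ≤ _ := sum_le_sum fun c hc => card_le_card_of_injOn (fun x => (x c.1, x c.2))
            (fun x hx => (mem_filter.1 hx).2)
            ((hinj c hc).mono fun x hx => (mem_filter.1 hx).1)
    have h2 : ∀ c ∈ 𝒞, (#(B c) : ℝ) ≤ 4 * α * n ^ 2 + act c := by
      intro c _
      have e1 := (card_union_le (univ.filter fun ω : W × W => ω.1 ∈ S ∨ ω.2 ∈ S)
        ((E c.1 c.2).filter (fun ω => condAvg (pairAtom 𝓐) (ind (E c.1 c.2)) ω < 2 * α)
        ∪ (E c.1 c.2).filter fun ω => pairAtom 𝓐 ω ∈ 𝓢 c)).trans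
        (Nat.add_le_add (card_pairs_small_le S) (card_union_le _ _))
      have e2 : (#(B c) : ℝ) ≤ 2 * (n * #S)
          + (#((E c.1 c.2).filter fun ω => condAvg (pairAtom 𝓐) (ind (E c.1 c.2)) ω < 2 * α)
            + act c) := by
        simp only [hn, hact, hB]; exact_mod_cast e1
      have e3 := card_sparse_le (pairAtom 𝓐) (E c.1 c.2) (β := 2 * α) (by positivity)
      rw [Fintype.card_prod, Nat.cast_mul, ← hn] at e3
      have e4 : n * #S ≤ n * (α * n) := by gcongr
      linarith
    have h3 : (#F : ℝ) ≤ ∑ c ∈ 𝒞, (4 * α * n ^ 2 + act c) := by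
      refine le_trans ?_ (sum_le_sum h2)
      exact_mod_cast h1
    rw [sum_add_distrib, sum_const, nsmul_eq_mul, ← hm] at h3
    have h4 : m * (4 * α * n ^ 2) = #F / 2 := by
      rw [hα]; field_simp; norm_num
    linarith
  have hinc : ∀ c ∈ 𝒞, ∃ 𝓣 : Finset (Finset W), #𝓣 ≤ 2 * 2 ^ r * #(𝓢 c) ∧
      ∀ 𝓐', 𝓐 ⊆ 𝓐' → 𝓣 ⊆ 𝓐' →
      entropy (pairAtom 𝓐) (ind (E c.1 c.2)) + 3 / (20 * (2 * m)) * act c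
        ≤ entropy (pairAtom 𝓐') (ind (E c.1 c.2)) := fun c _ =>
    entropy_increment_of_isShattered 𝓐 (E c.1 c.2) hα0.le (by positivity) (𝓢 c)
      (fun st hst => (mem_filter.1 hst).2.1) (fun st hst => (mem_filter.1 hst).2.2)
  choose! 𝓣 h𝓣card h𝓣 using hinc
  refine ⟨𝓐 ∪ 𝒞.biUnion 𝓣, ?_, ?_⟩
  · refine (card_union_le _ _).trans (Nat.add_le_add_left ?_ _)
    refine card_biUnion_le.trans ?_
    rw [← smul_eq_mul, ← sum_const]
    refine sum_le_sum fun c hc => (h𝓣card c hc).trans ?_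
    gcongr
    refine (card_filter_le _ _).trans (le_of_eq ?_)
    rw [card_product, card_powerset, ← mul_pow]; norm_num
  · calc ∑ c ∈ 𝒞, entropy (pairAtom 𝓐) (ind (E c.1 c.2)) + #F / (32 * m)
        ≤ ∑ c ∈ 𝒞, entropy (pairAtom 𝓐) (ind (E c.1 c.2))
          + 3 / (20 * (2 * m)) * ∑ c ∈ 𝒞, act c := by
          refine add_le_add_right ?_ _
          calc (#F : ℝ) / (32 * m) ≤ 3 / (20 * (2 * m)) * (#F / 2) := by
                rw [div_le_iff₀ (by positivity)]
                have : 3 / (20 * (2 * m)) * ((#F : ℝ) / 2) * (32 * m) = 6 / 5 * #F := by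
                  field_simp; norm_num
                rw [this]; linarith
            _ ≤ _ := by gcongr
      _ = ∑ c ∈ 𝒞, (entropy (pairAtom 𝓐) (ind (E c.1 c.2)) + 3 / (20 * (2 * m)) * act c) := by
          rw [sum_add_distrib, mul_sum]
      _ ≤ _ := sum_le_sum fun c hc => h𝓣 c hc _ subset_union_left
          ((subset_biUnion_of_mem 𝓣 hc).trans subset_union_right)

/-- A bound for the number of sets that generate the partition after `s` refinement steps. -/
def growth (m N : ℕ) : ℕ → ℕ
  | 0 => 0
  | s + 1 => growth m N s + m * (2 * N * 4 ^ growth m N s)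

theorem growth_mono (m N : ℕ) : Monotone (growth m N) :=
  monotone_nat_of_le_succ fun _ => Nat.le_add_right _ _

/-- Since `growth` is monotone, requiring few solutions relative to the final size `growth #𝒞 (2 ^
r) S` makes `exists_refinement` available at every earlier step. -/
theorem exists_iterated_refinement {W : Type*} [Fintype W] [DecidableEq W] {h : ℕ} (hh : 0 < h)
    (𝒞 : Finset (Fin h × Fin h)) (hne : 𝒞.Nonempty) (h𝒞 : ∀ c ∈ 𝒞, c.1 < c.2)
    (F : Finset (Fin h → W)) (hF : F.Nonempty) (E : Fin h → Fin h → Finset (W × W))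
    (hE : ∀ c ∈ 𝒞, ∀ x ∈ F, (x c.1, x c.2) ∈ E c.1 c.2)
    (hinj : ∀ c ∈ 𝒞, Set.InjOn (fun x : Fin h → W => (x c.1, x c.2)) F)
    {α γ : ℝ} (hα : α = #F / (8 * #𝒞 * (Fintype.card W : ℝ) ^ 2)) (hα1 : α ≤ 1) (hγ : 0 ≤ γ)
    (r : ℕ) (hr : (1 - (α ^ h / (2 * h)) ^ 2) ^ r ≤ 1 / 4) (hγr : 2 ^ r * γ ≤ 1 / 4) (S : ℕ)
    (hfew : (#(solutions (fun i j => (i, j) ∈ 𝒞) E fun _ => univ) : ℝ)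
      < (α ^ h / 2) ^ h * (γ * (α * Fintype.card W / 2 ^ growth #𝒞 (2 ^ r) S)) ^ h) :
    ∀ s ≤ S, ∃ 𝓐 : Finset (Finset W), #𝓐 ≤ growth #𝒞 (2 ^ r) s ∧
      ∑ c ∈ 𝒞, entropy (pairAtom ∅) (ind (E c.1 c.2)) + s * (#F / (32 * #𝒞))
        ≤ ∑ c ∈ 𝒞, entropy (pairAtom 𝓐) (ind (E c.1 c.2)) := by
  intro s
  induction s with
  | zero => intro _; exact ⟨∅, by simp [growth]⟩
  | succ s ih =>
    intro hs
    obtain ⟨𝓐, hcard, hent⟩ := ih (by omega)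
    have hα0 : 0 ≤ α := by rw [hα]; positivity
    obtain ⟨𝓐', hcard', hent'⟩ := exists_refinement hh 𝒞 hne h𝒞 F hF E hE hinj hα hα1 hγ r hr hγr 𝓐
      (hfew.trans_le (by
        gcongr
        · norm_num
        · exact hcard.trans (growth_mono _ _ (by omega))))
    refine ⟨𝓐', hcard'.trans ?_, ?_⟩
    · rw [growth]
      gcongr
      norm_num
    · push_cast
      linarith

theorem entropy_pairAtom_empty {W : Type*} [Fintype W] [DecidableEq W] (E : Finset (W × W))
    (hW : 0 < Fintype.card W) :
    entropy (pairAtom ∅) (ind E) = #E * Real.log (#E / (Fintype.card W : ℝ) ^ 2) := by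
  have hcell : cell (W := W) ∅ ∅ = univ := by ext x; simp [mem_cell, atom]
  have h1 : ∀ ω : W × W, condAvg (pairAtom ∅) (ind E) ω = #E / (Fintype.card W : ℝ) ^ 2 :=
    fun ω => by
      rw [condAvg_pairAtom ∅ E (st := (∅, ∅)) (by simp [pairAtom, atom])]
      simp [hcell, sq]
  have hW' : (0 : ℝ) < Fintype.card W := by exact_mod_cast hW
  simp only [entropy, h1, sum_const, card_univ, Fintype.card_prod, nsmul_eq_mul]
  push_cast
  field_simp

/-- A removal lemma for binary constraints between the coordinates of `x : Fin h → W`. -/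
theorem partite_removal {W : Type*} [Fintype W] [DecidableEq W] {h : ℕ} (hh : 0 < h)
    (𝒞 : Finset (Fin h × Fin h)) (hne : 𝒞.Nonempty) (h𝒞 : ∀ c ∈ 𝒞, c.1 < c.2)
    (E : Fin h → Fin h → Finset (W × W)) {ε α γ : ℝ} (hε : 0 < ε)
    (hα0 : 0 < α) (hα : α ≤ ε / (8 * #𝒞 ^ 2)) (hγ : 0 ≤ γ) (r : ℕ)
    (hr : (1 - (α ^ h / (2 * h)) ^ 2) ^ r ≤ 1 / 4) (hγr : 2 ^ r * γ ≤ 1 / 4) (S : ℕ)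
    (hS : 32 * (#𝒞 : ℝ) ^ 2 * Real.log (#𝒞 / ε) < S)
    (hfew : (#(solutions (fun i j => (i, j) ∈ 𝒞) E fun _ => univ) : ℝ)
      < (α ^ h / 2) ^ h * (γ * (α * Fintype.card W / 2 ^ growth #𝒞 (2 ^ r) S)) ^ h) :
    ∃ Z : Finset (W × W), (#Z : ℝ) ≤ ε * (Fintype.card W : ℝ) ^ 2 ∧
      ∀ x : Fin h → W, (∀ c ∈ 𝒞, (x c.1, x c.2) ∈ E c.1 c.2) → ∃ c ∈ 𝒞, (x c.1, x c.2) ∈ Z := by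
  classical
  set sols := solutions (fun i j => (i, j) ∈ 𝒞) E fun _ => univ with hsols
  set good : Finset (Finset (Fin h → W)) := sols.powerset.filter fun F =>
    ∀ c ∈ 𝒞, Set.InjOn (fun x : Fin h → W => (x c.1, x c.2)) F with hgood
  obtain ⟨F, hFmem, hFmax⟩ := exists_max_image good card
    ⟨∅, mem_filter.2 ⟨mem_powerset.2 (empty_subset _), by simp⟩⟩
  obtain ⟨hFsub, hinj⟩ := mem_filter.1 hFmem
  rw [mem_powerset] at hFsub
  have hm0 : (0 : ℝ) < #𝒞 := by exact_mod_cast card_pos.2 hne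
  have hm1 : (1 : ℝ) ≤ #𝒞 := by exact_mod_cast card_pos.2 hne
  -- Only pairs used by F are kept: each constraint then has exactly |F| pairs, and no new solutions
  -- appear because F consists of solutions.
  set E' : Fin h → Fin h → Finset (W × W) := fun i j => F.image fun x => (x i, x j) with hE'
  by_cases hle : (#𝒞 * #F : ℝ) ≤ ε * (Fintype.card W : ℝ) ^ 2
  · refine ⟨𝒞.biUnion fun c => E' c.1 c.2, le_trans ?_ hle, ?_⟩
    · have : #(𝒞.biUnion fun c => E' c.1 c.2) ≤ #𝒞 * #F :=
        card_biUnion_le_card_mul _ _ _ fun c _ => card_image_le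
      exact_mod_cast this
    · intro x hx
      have hxs : x ∈ sols := mem_solutions.2 ⟨fun _ => mem_univ _, fun i j hij => hx (i, j) hij⟩
      by_cases hxF : x ∈ F
      · obtain ⟨c, hc⟩ := hne
        exact ⟨c, hc, mem_biUnion.2 ⟨c, hc, mem_image_of_mem _ hxF⟩⟩
      · have hnot : insert x F ∉ good := fun hmem => by
          have := hFmax _ hmem
          rw [card_insert_of_notMem hxF] at this
          omega
        have hsub : insert x F ⊆ sols := insert_subset hxs hFsub
        have : ∃ c ∈ 𝒞, ¬ Set.InjOn (fun x : Fin h → W => (x c.1, x c.2)) (insert x F : Finset _) := by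
          by_contra hcon
          push Not at hcon
          exact hnot (mem_filter.2 ⟨mem_powerset.2 hsub, hcon⟩)
        obtain ⟨c, hc, hcinj⟩ := this
        rw [coe_insert, Set.injOn_insert (by simpa using hxF)] at hcinj
        have hmem : (x c.1, x c.2) ∈ (fun x : Fin h → W => (x c.1, x c.2)) '' F := by
          by_contra hcon
          exact hcinj ⟨hinj c hc, hcon⟩
        obtain ⟨y, hy, hyx⟩ := hmem
        exact ⟨c, hc, mem_biUnion.2 ⟨c, hc, mem_image.2 ⟨y, hy, hyx⟩⟩⟩
  · exfalso
    push Not at hle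
    have hF : F.Nonempty := by
      rw [nonempty_iff_ne_empty]
      rintro rfl
      have : 0 ≤ ε * (Fintype.card W : ℝ) ^ 2 := by positivity
      simp at hle
      linarith
    obtain ⟨x₀, hx₀⟩ := hF
    have hW : 0 < Fintype.card W := Fintype.card_pos_iff.2 ⟨x₀ ⟨0, hh⟩⟩
    set n : ℝ := ((Fintype.card W : ℕ) : ℝ) with hn
    have hn0 : 0 < n := by rw [hn]; exact_mod_cast hW
    have hF0 : (0 : ℝ) < #F := by exact_mod_cast card_pos.2 ⟨x₀, hx₀⟩
    set m : ℝ := ((#𝒞 : ℕ) : ℝ) with hm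
    have hFn : (#F : ℝ) ≤ n ^ 2 := by
      obtain ⟨c, hc⟩ := hne
      have := card_le_card_of_injOn (s := F) (t := (univ : Finset (W × W)))
        (fun x : Fin h → W => (x c.1, x c.2)) (fun _ _ => mem_univ _) (hinj c hc)
      rw [card_univ, Fintype.card_prod] at this
      rw [hn, sq]
      exact_mod_cast this
    have hcardE : ∀ c ∈ 𝒞, #(E' c.1 c.2) = #F := fun c hc => card_image_of_injOn (hinj c hc)
    -- The threshold that the refinement step needs depends on |F|. It is at least α because m|F| >
    -- εn², and every hypothesis on α passes to larger values up to 1.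
    set β : ℝ := #F / (8 * m * n ^ 2) with hβ
    have hβ1 : β ≤ 1 := by
      rw [hβ, div_le_one (by positivity)]
      nlinarith [mul_pos hm0 (pow_pos hn0 2)]
    have hεd : ε / m ≤ #F / n ^ 2 := by
      rw [div_le_div_iff₀ hm0 (by positivity)]
      linarith
    have hαβ : α ≤ β := by
      refine hα.trans ?_
      have e1 : ε / (8 * m ^ 2) = ε / m / (8 * m) := by field_simp
      have e2 : β = #F / n ^ 2 / (8 * m) := by rw [hβ]; field_simp
      rw [e1, e2]
      gcongr
    have hβ0 : 0 < β := hα0.trans_le hαβ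
    have hhr : (1 : ℝ) ≤ h := by exact_mod_cast hh
    have hr' : (1 - (β ^ h / (2 * h)) ^ 2) ^ r ≤ 1 / 4 := by
      refine le_trans ?_ hr
      have h1 : β ^ h / (2 * h) ≤ 1 := by
        rw [div_le_one (by positivity)]
        have := pow_le_one₀ (n := h) hβ0.le hβ1
        linarith
      have h2 : (β ^ h / (2 * h)) ^ 2 ≤ 1 := pow_le_one₀ (by positivity) h1
      have h3 : 0 ≤ 1 - (β ^ h / (2 * h)) ^ 2 := by linarith
      gcongr
    have hsub : solutions (fun i j => (i, j) ∈ 𝒞) E' (fun _ => univ) ⊆ sols := by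
      intro x hx
      refine mem_solutions.2 ⟨fun _ => mem_univ _, fun i j hij => ?_⟩
      obtain ⟨y, hy, hyx⟩ := mem_image.1 ((mem_solutions.1 hx).2 i j hij)
      rw [← hyx]
      exact (mem_solutions.1 (hFsub hy)).2 i j hij
    have hsub' : (#(solutions (fun i j => (i, j) ∈ 𝒞) E' fun _ => univ) : ℝ) ≤ #sols := by
      exact_mod_cast card_le_card hsub
    obtain ⟨𝓐, -, hent⟩ := exists_iterated_refinement hh 𝒞 hne h𝒞 F ⟨x₀, hx₀⟩ E'
      (fun c _ x hx => mem_image_of_mem _ hx) hinj hβ hβ1 hγ r hr' hγr S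
      (hsub'.trans_lt (hfew.trans_le (by gcongr))) S le_rfl
    have hup : ∑ c ∈ 𝒞, entropy (pairAtom 𝓐) (ind (E' c.1 c.2)) ≤ 0 :=
      sum_nonpos fun c _ => entropy_nonpos _ (ind_nonneg _) (ind_le_one _)
    have hlow : ∑ c ∈ 𝒞, entropy (pairAtom ∅) (ind (E' c.1 c.2))
        = m * (#F * Real.log (#F / n ^ 2)) := by
      rw [sum_congr rfl fun c hc => by rw [entropy_pairAtom_empty _ hW, hcardE c hc], sum_const,
        nsmul_eq_mul]
    have hlog : -Real.log (m / ε) ≤ Real.log (#F / n ^ 2) := by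
      rw [← Real.log_inv, inv_div]
      exact Real.log_le_log (by positivity) hεd
    -- The initial potential is at least -m|F| log(m/ε), while S steps add more than m|F| log(m/ε);
    -- the final potential would be positive.
    rw [hlow] at hent
    have h1 : m * (#F * Real.log (#F / n ^ 2)) ≥ m * (#F * (-Real.log (m / ε))) := by gcongr
    have h2 : (S : ℝ) * (#F / (32 * m)) > 32 * m ^ 2 * Real.log (m / ε) * (#F / (32 * m)) := by
      gcongr
    have h3 : 32 * m ^ 2 * Real.log (m / ε) * (#F / (32 * m)) = m * (#F * Real.log (m / ε)) := by
      field_simp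
    linarith

/-! ### Tower arithmetic and explicit parameters. -/

theorem lt_tower : ∀ k, k < tower k
  | 0 => by simp [tower]
  | k + 1 => by
    have := lt_tower k
    have h2 : tower k < tower (k + 1) := Nat.lt_two_pow_self
    omega

theorem tower_mono : Monotone tower :=
  monotone_nat_of_le_succ fun _ => Nat.lt_two_pow_self.le

theorem tower_pos (k : ℕ) : 0 < tower k := (Nat.zero_le k).trans_lt (lt_tower k)

theorem two_pow_le_tower {x j : ℕ} (hx : x ≤ tower j) : 2 ^ x ≤ tower (j + 1) :=
  Nat.pow_le_pow_right (by norm_num) hx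

theorem add_le_tower {x y j : ℕ} (hx : x ≤ tower j) (hy : y ≤ tower j) :
    x + y ≤ tower (j + 1) := by
  have h0 := tower_pos j
  have : 2 * tower j ≤ 2 ^ tower j := by
    obtain ⟨t, ht⟩ := Nat.exists_eq_succ_of_ne_zero h0.ne'
    rw [ht, pow_succ, mul_comm]
    exact Nat.mul_le_mul_right _ (Nat.succ_le_of_lt Nat.lt_two_pow_self)
  change _ ≤ 2 ^ tower j
  omega

theorem mul_le_tower {x y j : ℕ} (hx : x ≤ tower j) (hy : y ≤ tower j) :
    x * y ≤ tower (j + 2) := by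
  calc x * y ≤ 2 ^ x * 2 ^ y := Nat.mul_le_mul Nat.lt_two_pow_self.le Nat.lt_two_pow_self.le
    _ = 2 ^ (x + y) := (pow_add _ _ _).symm
    _ ≤ tower (j + 1 + 1) := two_pow_le_tower (add_le_tower hx hy)

theorem pow_le_tower {x y j : ℕ} (hx : x ≤ tower j) (hy : y ≤ tower j) :
    x ^ y ≤ tower (j + 3) := by
  calc x ^ y ≤ (2 ^ x) ^ y := Nat.pow_le_pow_left Nat.lt_two_pow_self.le _
    _ = 2 ^ (x * y) := (pow_mul _ _ _).symm
    _ ≤ tower (j + 2 + 1) := two_pow_le_tower (mul_le_tower hx hy)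

theorem le_tower_of_le {x i j : ℕ} (hx : x ≤ tower i) (hij : i ≤ j) : x ≤ tower j :=
  hx.trans (tower_mono hij)

/-- One refinement takes a power, two products and a sum in succession, costing 3 + 2 + 2 + 1 = 8
levels. -/
theorem growth_le_tower {m N j : ℕ} (hm : m ≤ tower j) (hN : N ≤ tower j) (h4 : 4 ≤ tower j) :
    ∀ s, growth m N s ≤ tower (j + 8 * s)
  | 0 => Nat.zero_le _
  | s + 1 => by
    have ih := growth_le_tower hm hN h4 s
    set i := j + 8 * s with hi
    have hji : j ≤ i := by omega
    have e1 : 2 * N ≤ tower (i + 3) := le_tower_of_le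
      (mul_le_tower (j := i) (le_tower_of_le (by omega) hji) (le_tower_of_le hN hji)) (by omega)
    have e2 := pow_le_tower (le_tower_of_le h4 hji) ih
    have e3 := mul_le_tower e1 e2
    have e4 := mul_le_tower (le_tower_of_le hm (by omega : j ≤ i + 3 + 2)) e3
    have e5 := add_le_tower (le_tower_of_le ih (by omega : i ≤ i + 3 + 2 + 2)) e4
    rw [growth]
    refine le_tower_of_le e5 (by omega)

/-- The number of refinement rounds inside one pair of cells when densities are compared
with `1 / T`. -/
def rounds (h T : ℕ) : ℕ := 2 * (2 * h * T ^ h) ^ 2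

/-- The reciprocal of the density of solutions that suffices for `S` refinement steps. -/
def solutionBound (h m T S : ℕ) : ℕ :=
  (2 * T ^ h * (2 ^ (rounds h T + 2) * T * 2 ^ growth m (2 ^ rounds h T) S)) ^ h

theorem solutionBound_le_tower {h m j S : ℕ} (hh : h ≤ tower j) (hm : m ≤ tower j)
    (h4 : 4 ≤ tower j) : solutionBound h m (tower j) S ≤ tower (j + 22 + 8 * S) := by
  have p1 := pow_le_tower (le_refl (tower j)) hh
  have p2 : 2 * h ≤ tower (j + 3) := le_tower_of_le
    (mul_le_tower (j := j) (by omega) hh) (by omega)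
  have p3 := pow_le_tower (mul_le_tower p2 p1)
    (le_tower_of_le (by omega : 2 ≤ tower j) (by omega : j ≤ j + 3 + 2))
  have hr : rounds h (tower j) ≤ tower (j + 10) :=
    mul_le_tower (le_tower_of_le (by omega : 2 ≤ tower j) (by omega)) p3
  have hN : 2 ^ rounds h (tower j) ≤ tower (j + 11) := two_pow_le_tower hr
  have hg := growth_le_tower (le_tower_of_le hm (by omega : j ≤ j + 11)) hN
    (le_tower_of_le h4 (by omega)) S
  set i := j + 11 + 8 * S with hi
  have q1 : 2 * tower j ^ h ≤ tower (i + 6) := le_tower_of_le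
    (mul_le_tower (le_tower_of_le (by omega : 2 ≤ tower j) (by omega : j ≤ j + 3)) p1) (by omega)
  have q2 : 2 ^ (rounds h (tower j) + 2) ≤ tower (i + 2) := two_pow_le_tower
    (le_tower_of_le (add_le_tower hr (le_tower_of_le (by omega : 2 ≤ tower j) (by omega)))
      (by omega))
  have q3 := mul_le_tower q2 (le_tower_of_le le_rfl (by omega : j ≤ i + 2))
  have q4 := mul_le_tower q3 (le_tower_of_le (two_pow_le_tower hg) (by omega : i + 1 ≤ i + 2 + 2))
  have q5 := pow_le_tower (mul_le_tower q1 q4) (le_tower_of_le hh (by omega))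
  exact le_tower_of_le q5 (by omega)

/-- `partite_removal` with explicit parameters. -/
theorem partite_removal_nat {W : Type*} [Fintype W] [DecidableEq W] {h : ℕ} (hh : 0 < h)
    (𝒞 : Finset (Fin h × Fin h)) (hne : 𝒞.Nonempty) (h𝒞 : ∀ c ∈ 𝒞, c.1 < c.2)
    (E : Fin h → Fin h → Finset (W × W)) {ε : ℝ} (hε : 0 < ε) (T S : ℕ) (hT0 : 0 < T)
    (hT : 8 * #𝒞 ^ 2 / ε ≤ T) (hS : 32 * (#𝒞 : ℝ) ^ 2 * Real.log (#𝒞 / ε) < S)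
    (hfew : (#(solutions (fun i j => (i, j) ∈ 𝒞) E fun _ => univ) : ℝ)
      * solutionBound h #𝒞 T S < (Fintype.card W : ℝ) ^ h) :
    ∃ Z : Finset (W × W), (#Z : ℝ) ≤ ε * (Fintype.card W : ℝ) ^ 2 ∧
      ∀ x : Fin h → W, (∀ c ∈ 𝒞, (x c.1, x c.2) ∈ E c.1 c.2) → ∃ c ∈ 𝒞, (x c.1, x c.2) ∈ Z := by
  have hTr : (0 : ℝ) < T := by exact_mod_cast hT0
  have hhr : (0 : ℝ) < h := by exact_mod_cast hh
  have hm0 : (0 : ℝ) < #𝒞 := by exact_mod_cast card_pos.2 hne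
  -- γ is chosen so that 2^r γ = 1/4 with r = `rounds h T`. With α = 1/T, `solutionBound` is then
  -- exactly the reciprocal of the required solution density.
  refine partite_removal hh 𝒞 hne h𝒞 E hε (α := 1 / T) (γ := 1 / 2 ^ (rounds h T + 2))
    (by positivity) ?_ (by positivity) (rounds h T) ?_ ?_ S hS ?_
  · rw [div_le_iff₀ hε] at hT
    rw [div_le_div_iff₀ hTr (by positivity)]
    linarith
  · set η : ℝ := (1 / (T : ℝ)) ^ h / (2 * h) with hη
    have hη0 : 0 < η := by positivity
    have hη1 : η ≤ 1 := by
      rw [hη, div_le_one (by positivity)]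
      have h1 : (1 : ℝ) ≤ h := by exact_mod_cast hh
      have h2 : (1 / (T : ℝ)) ^ h ≤ 1 := pow_le_one₀ (by positivity) (by
        rw [div_le_one hTr]; exact_mod_cast hT0)
      linarith
    -- This gives (1 - η²)^r ≤ e⁻² < 1/4.
    have h1 : (rounds h T : ℝ) * η ^ 2 = 2 := by
      rw [hη, rounds, one_div_pow]
      push_cast
      field_simp
    calc (1 - η ^ 2) ^ rounds h T ≤ (Real.exp (-η ^ 2)) ^ rounds h T := by
          have h2 : 0 ≤ 1 - η ^ 2 := by nlinarith
          gcongr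
          have := Real.add_one_le_exp (-η ^ 2)
          linarith
      _ = (Real.exp 1 ^ 2)⁻¹ := by
          rw [← Real.exp_nat_mul, ← Real.exp_nat_mul, ← Real.exp_neg]
          congr 1
          push_cast
          linarith
      _ ≤ 1 / 4 := by
          have := Real.exp_one_gt_d9
          rw [inv_eq_one_div]
          refine one_div_le_one_div_of_le (by norm_num) ?_
          nlinarith
  · rw [pow_add]
    have : (0 : ℝ) < 2 ^ rounds h T := by positivity
    field_simp
    norm_num
  · have hX : (0 : ℝ) < solutionBound h #𝒞 T S := by
      rw [solutionBound]; positivity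
    rw [← lt_div_iff₀ hX] at hfew
    refine hfew.trans_le (le_of_eq ?_)
    rw [solutionBound]
    push_cast
    rw [← mul_pow, ← div_pow, one_div_pow (T : ℝ) h]
    congr 1
    field_simp

/-! ### From digraphs to binary constraints. -/

/-- An injective homomorphism count in terms of the number of copies. -/
theorem card_injective_homs_le {h n : ℕ} (H : Digraph (Fin h)) (G : Digraph (Fin n))
    (s : Finset (Fin h → Fin n)) (hs : ∀ x ∈ s, Function.Injective x ∧
      ∀ u v, H.Adj u v → G.Adj (x u) (x v)) : #s ≤ h ^ h * copyCount H G := by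
  classical
  set img : (Fin h → Fin n) → Set (Fin n) × Set (Fin n × Fin n) := fun x =>
    (Set.range x, {e | ∃ u v, H.Adj u v ∧ e = (x u, x v)}) with himg
  have h1 : ((s.image img : Finset _) : Set _) ⊆ copies H G := by
    intro S hS
    obtain ⟨x, hx, rfl⟩ := mem_image.1 hS
    exact ⟨⟨x, (hs x hx).1⟩, (hs x hx).2, rfl⟩
  have h2 : #(s.image img) ≤ copyCount H G := by
    rw [← Set.ncard_coe_finset]
    exact Set.ncard_le_ncard h1 (Set.toFinite _)
  refine (card_le_mul_card_image s (h ^ h) (f := img) fun S hS => ?_).trans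
    (Nat.mul_le_mul_left _ h2)
  obtain ⟨x, hx, rfl⟩ := mem_image.1 hS
  -- Maps with the same image have the same vertex set, so all their values lie in the h-element
  -- range of x.
  have h3 : s.filter (fun y => img y = img x)
      ⊆ Fintype.piFinset fun _ : Fin h => univ.image x := by
    intro y hy
    have := congrArg Prod.fst (mem_filter.1 hy).2
    refine Fintype.mem_piFinset.2 fun i => ?_
    have h4 : y i ∈ Set.range x := by
      have h5 : Set.range y = Set.range x := this
      rw [← h5]; exact Set.mem_range_self i
    simpa using h4
  refine (card_le_card h3).trans ?_
  rw [Fintype.card_piFinset, prod_const, card_univ, Fintype.card_fin]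
  gcongr
  exact card_image_le.trans (by simp)

/-- If x a = x b with a ≠ b, then x is determined by its values off a; there are at most h² choices
of (a, b). -/
theorem card_noninjective_le (h n : ℕ) :
    #(univ.filter fun x : Fin h → Fin n => ¬ Function.Injective x) ≤ h ^ 2 * n ^ (h - 1) := by
  classical
  have h1 : (univ.filter fun x : Fin h → Fin n => ¬ Function.Injective x)
      ⊆ (univ : Finset (Fin h × Fin h)).biUnion fun p =>
        univ.filter fun x : Fin h → Fin n => p.1 ≠ p.2 ∧ x p.1 = x p.2 := by
    intro x hx
    have hx := (mem_filter.1 hx).2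
    simp only [Function.Injective, not_forall] at hx
    obtain ⟨a, b, hab, hne⟩ := hx
    exact mem_biUnion.2 ⟨(a, b), mem_univ _, mem_filter.2 ⟨mem_univ _, hne, hab⟩⟩
  refine (card_le_card h1).trans ((card_biUnion_le_card_mul _ _ (n ^ (h - 1)) ?_).trans ?_)
  · rintro ⟨a, b⟩ -
    have h2 := card_le_card_of_injOn
      (s := univ.filter fun x : Fin h → Fin n => a ≠ b ∧ x a = x b)
      (t := (univ : Finset ({k : Fin h // k ≠ a} → Fin n))) (fun x k => x k)
      (fun _ _ => mem_coe.2 (mem_univ _)) (by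
        intro x hx y hy hxy
        have hx := (mem_filter.1 hx).2
        have hy := (mem_filter.1 hy).2
        have hk : ∀ k, k ≠ a → x k = y k := fun k hk => congrFun hxy ⟨k, hk⟩
        funext k
        by_cases hka : k = a
        · rw [hka, hx.2, hy.2]; exact hk b hx.1.symm
        · exact hk k hka)
    refine h2.trans (le_of_eq ?_)
    rw [card_univ, Fintype.card_fun, Fintype.card_fin, Fintype.card_subtype_compl]
    simp
  · rw [card_univ, Fintype.card_prod, Fintype.card_fin, sq]

theorem isFree_of_copyCount_eq_zero {h n : ℕ} {H : Digraph (Fin h)} {G : Digraph (Fin n)}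
    (hc : copyCount H G = 0) : IsFree H G :=
  (Set.ncard_eq_zero (Set.toFinite _)).1 hc

theorem removedEdges_self {W : Type*} (G : Digraph W) : removedEdges G G = ∅ := by
  ext e; simp [removedEdges]

/-- If `H` has a loop, then deleting all loops destroys every copy of `H`. -/
theorem exists_free_of_loop {h n : ℕ} (H : Digraph (Fin h)) (G : Digraph (Fin n)) {u : Fin h}
    (hu : H.Adj u u) :
    ∃ G' : Digraph (Fin n), G' ≤ G ∧ (removedEdges G G').ncard ≤ n ∧ IsFree H G' := by
  refine ⟨⟨fun a b => G.Adj a b ∧ a ≠ b⟩, fun a b hab => hab.1, ?_, ?_⟩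
  · have : removedEdges G ⟨fun a b => G.Adj a b ∧ a ≠ b⟩ ⊆ Set.range fun a : Fin n => (a, a) := by
      rintro ⟨a, b⟩ ⟨h1, h2⟩
      have : a = b := by by_contra h3; exact h2 ⟨h1, h3⟩
      exact ⟨a, by rw [this]⟩
    refine (Set.ncard_le_ncard this (Set.toFinite _)).trans ?_
    rw [← Set.image_univ]
    exact (Set.ncard_image_le (Set.toFinite _)).trans (by simp)
  · refine Set.eq_empty_iff_forall_notMem.2 ?_
    rintro S ⟨f, hf, -⟩
    exact (hf u u hu).2 rfl

/-- The digraph removal lemma for a loopless pattern, with explicit parameters. -/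
theorem loopless_removal {h n : ℕ} (hh : 0 < h) (hn : 0 < n) (H : Digraph (Fin h))
    (hH : ∀ u, ¬ H.Adj u u) (G : Digraph (Fin n)) {ε : ℝ} (hε : 0 < ε) (T S B : ℕ) (hT0 : 0 < T)
    (hT : 16 * (h : ℝ) ^ 4 / ε ≤ T)
    (hS : ∀ m : ℕ, 0 < m → m ≤ h ^ 2 → 32 * (m : ℝ) ^ 2 * Real.log (2 * m / ε) < S)
    (hB : ∀ m ≤ h ^ 2, solutionBound h m T S ≤ B)
    (hfew : ((h : ℝ) ^ h * copyCount H G + (h : ℝ) ^ 2 * (n : ℝ) ^ (h - 1)) * B < (n : ℝ) ^ h) :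
    ∃ G' : Digraph (Fin n), G' ≤ G ∧
      ((removedEdges G G').ncard : ℝ) ≤ ε * (n : ℝ) ^ 2 ∧ IsFree H G' := by
  classical
  set 𝒞 : Finset (Fin h × Fin h) :=
    univ.filter fun c => c.1 < c.2 ∧ (H.Adj c.1 c.2 ∨ H.Adj c.2 c.1) with h𝒞
  set E : Fin h → Fin h → Finset (Fin n × Fin n) := fun i j => univ.filter fun e =>
    (H.Adj i j → G.Adj e.1 e.2) ∧ (H.Adj j i → G.Adj e.2 e.1) with hE
  set sols := solutions (fun i j => (i, j) ∈ 𝒞) E fun _ => univ with hsols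
  have hm : #𝒞 ≤ h ^ 2 := by
    refine (card_le_univ _).trans ?_
    rw [Fintype.card_prod, Fintype.card_fin, sq]
  have hsolcard : #sols ≤ h ^ h * copyCount H G + h ^ 2 * n ^ (h - 1) := by
    rw [← card_filter_add_card_filter_not (s := sols) (fun x => Function.Injective x)]
    refine Nat.add_le_add (card_injective_homs_le H G _ ?_) ?_
    · intro x hx
      obtain ⟨hx, hinj⟩ := mem_filter.1 hx
      refine ⟨hinj, fun u v huv => ?_⟩
      have hxs := (mem_solutions.1 hx).2
      rcases lt_trichotomy u v with huv' | rfl | huv'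
      · exact (mem_filter.1 (hxs u v (mem_filter.2 ⟨mem_univ _, huv', Or.inl huv⟩))).2.1 huv
      · exact absurd huv (hH u)
      · exact (mem_filter.1 (hxs v u (mem_filter.2 ⟨mem_univ _, huv', Or.inr huv⟩))).2.2 huv
    · refine (card_le_card ?_).trans (card_noninjective_le h n)
      intro x hx
      exact mem_filter.2 ⟨mem_univ _, (mem_filter.1 hx).2⟩
  have hsolcard' : (#sols : ℝ) ≤ (h : ℝ) ^ h * copyCount H G + (h : ℝ) ^ 2 * (n : ℝ) ^ (h - 1) := by
    exact_mod_cast hsolcard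
  have hfew' : (#sols : ℝ) * solutionBound h #𝒞 T S < (n : ℝ) ^ h := by
    refine lt_of_le_of_lt ?_ hfew
    have : (solutionBound h #𝒞 T S : ℝ) ≤ B := by exact_mod_cast hB _ hm
    gcongr
  -- Without constraints all n^h maps would be solutions, contradicting `hfew'`.
  have hne : 𝒞.Nonempty := by
    rw [nonempty_iff_ne_empty]
    intro hemp
    have h1 : sols = univ := by
      ext x
      simp [hsols, mem_solutions, hemp]
    rw [h1, card_univ, Fintype.card_fun, Fintype.card_fin, Fintype.card_fin] at hfew'
    have h2 : (1 : ℝ) ≤ solutionBound h #𝒞 T S := by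
      have : 0 < solutionBound h #𝒞 T S := by rw [solutionBound]; positivity
      exact_mod_cast this
    have h3 : (0 : ℝ) ≤ (n : ℝ) ^ h := by positivity
    push_cast at hfew'
    nlinarith
  have hm0 : (0 : ℝ) < #𝒞 := by exact_mod_cast card_pos.2 hne
  have hmr : (#𝒞 : ℝ) ≤ (h : ℝ) ^ 2 := by exact_mod_cast hm
  -- Applied with ε/2, because a pair in `Z` costs the edges in both directions.
  obtain ⟨Z, hZ, hZx⟩ := partite_removal_nat hh 𝒞 hne (fun c hc => (mem_filter.1 hc).2.1) E
    (half_pos hε) T S hT0 (by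
      refine le_trans ?_ hT
      rw [div_div_eq_mul_div]
      refine div_le_div_of_nonneg_right ?_ hε.le
      calc 8 * (#𝒞 : ℝ) ^ 2 * 2 ≤ 8 * ((h : ℝ) ^ 2) ^ 2 * 2 := by gcongr
        _ = 16 * (h : ℝ) ^ 4 := by ring)
    (by
      have := hS #𝒞 (card_pos.2 hne) hm
      rwa [div_div_eq_mul_div, mul_comm (#𝒞 : ℝ) 2])
    (by simpa using hfew')
  rw [Fintype.card_fin] at hZ
  refine ⟨⟨fun a b => G.Adj a b ∧ (a, b) ∉ Z ∧ (b, a) ∉ Z⟩, fun a b hab => hab.1, ?_, ?_⟩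
  · have hsub : removedEdges G ⟨fun a b => G.Adj a b ∧ (a, b) ∉ Z ∧ (b, a) ∉ Z⟩
        ⊆ ((Z ∪ Z.image Prod.swap : Finset _) : Set (Fin n × Fin n)) := by
      rintro ⟨a, b⟩ ⟨h1, h2⟩
      simp only [coe_union, Set.mem_union, mem_coe, mem_image, Prod.exists]
      by_contra h3
      push Not at h3
      refine h2 ⟨h1, h3.1, fun h4 => h3.2 b a h4 rfl⟩
    have h1 := Set.ncard_le_ncard hsub (Set.toFinite _)
    rw [Set.ncard_coe_finset] at h1
    have h2 : (removedEdges G ⟨fun a b => G.Adj a b ∧ (a, b) ∉ Z ∧ (b, a) ∉ Z⟩).ncard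
        ≤ #Z + #Z :=
      h1.trans ((card_union_le _ _).trans (Nat.add_le_add_left card_image_le _))
    have h3 : ((removedEdges G ⟨fun a b => G.Adj a b ∧ (a, b) ∉ Z ∧ (b, a) ∉ Z⟩).ncard : ℝ)
        ≤ #Z + #Z := by exact_mod_cast h2
    linarith
  · refine Set.eq_empty_iff_forall_notMem.2 ?_
    rintro S ⟨f, hf, -⟩
    obtain ⟨c, hc, hcZ⟩ := hZx f fun c hc => mem_filter.2 ⟨mem_univ _,
      fun h1 => (hf _ _ h1).1, fun h1 => (hf _ _ h1).1⟩
    rcases (mem_filter.1 hc).2.2 with h1 | h1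
    · exact (hf _ _ h1).2.1 hcZ
    · exact (hf _ _ h1).2.2 hcZ

/-! ### Choice of parameters and the main theorem. -/

theorem inv_le_tower {ε : ℝ} (hε : 0 < ε) {ℓ : ℕ} (hℓ : Real.log (1 / ε) ≤ ℓ) :
    1 / ε ≤ (tower (2 * ℓ + 1) : ℝ) := by
  have h1 : 1 / ε ≤ Real.exp ℓ := by
    rw [← Real.log_le_iff_le_exp (by positivity)]; exact hℓ
  have h2 : Real.exp ℓ ≤ 4 ^ ℓ := by
    rw [← mul_one (ℓ : ℝ), Real.exp_nat_mul]
    have := Real.exp_one_lt_d9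
    gcongr
    linarith
  have h3 : 4 ^ ℓ ≤ tower (2 * ℓ + 1) := by
    have := two_pow_le_tower (lt_tower (2 * ℓ)).le
    rwa [pow_mul] at this
  have h3' : (4 : ℝ) ^ ℓ ≤ (tower (2 * ℓ + 1) : ℝ) := by exact_mod_cast h3
  exact h1.trans (h2.trans h3')

/-- Since log(2m) ≤ 2m - 1 ≤ 2h²L, the number of steps is O_h(ℓ); the final + 1 makes the inequality
strict. -/
theorem log_bound {ε L : ℝ} (hε : 0 < ε) (hL1 : 1 ≤ L) (hL : Real.log (1 / ε) ≤ L) {h ℓ m : ℕ}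
    (hℓ : L ≤ ℓ) (hm0 : 0 < m) (hm : m ≤ h ^ 2) :
    32 * (m : ℝ) ^ 2 * Real.log (2 * m / ε) < (32 * h ^ 4 * (2 * h ^ 2 + 1) * ℓ + 1 : ℕ) := by
  have hm0' : (0 : ℝ) < m := by exact_mod_cast hm0
  have hm' : (m : ℝ) ≤ (h : ℝ) ^ 2 := by exact_mod_cast hm
  have h1 : Real.log (2 * m / ε) ≤ (2 * h ^ 2 + 1) * ℓ := by
    have e1 : Real.log (2 * m / ε) = Real.log (2 * m) + Real.log (1 / ε) := by
      rw [← Real.log_mul (by positivity) (by positivity)]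
      congr 1; ring
    have e2 := Real.log_le_sub_one_of_pos (x := 2 * m) (by positivity)
    have e3 : (2 * (h : ℝ) ^ 2 + 1) * L ≤ (2 * h ^ 2 + 1) * ℓ := by gcongr
    have e4 : (2 * (h : ℝ) ^ 2) * 1 ≤ (2 * (h : ℝ) ^ 2) * L := by gcongr
    linarith
  have h2 : (0 : ℝ) ≤ (2 * h ^ 2 + 1) * ℓ := by positivity
  calc 32 * (m : ℝ) ^ 2 * Real.log (2 * m / ε)
      ≤ 32 * (m : ℝ) ^ 2 * ((2 * h ^ 2 + 1) * ℓ) := by gcongr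
    _ ≤ 32 * ((h : ℝ) ^ 2) ^ 2 * ((2 * h ^ 2 + 1) * ℓ) := by gcongr
    _ < _ := by push_cast; nlinarith

/-- Few copies and many vertices give few homomorphisms. -/
theorem homs_bound {h n B Y : ℕ} (hh : 0 < h) (hB : 0 < B) {cc δ : ℝ}
    (hδ : δ⁻¹ = Y) (hcc : cc ≤ δ * (n : ℝ) ^ h) (hY : (3 * B * h ^ (h + 2)) ^ h ≤ Y)
    (hn : 3 * B * h ^ (h + 2) ≤ n) :
    ((h : ℝ) ^ h * cc + (h : ℝ) ^ 2 * (n : ℝ) ^ (h - 1)) * B < (n : ℝ) ^ h := by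
  have hD1 : 0 < 3 * B * h ^ (h + 2) := by positivity
  have hn0 : (0 : ℝ) < n := by exact_mod_cast hD1.trans_le hn
  have hN : (0 : ℝ) < (n : ℝ) ^ h := by positivity
  have hY1 : 3 * B * h ^ h ≤ Y := by
    calc 3 * B * h ^ h ≤ 3 * B * h ^ (h + 2) := by gcongr; omega
      _ ≤ (3 * B * h ^ (h + 2)) ^ h := Nat.le_self_pow hh.ne' _
      _ ≤ Y := hY
  have hY1' : (3 * B * h ^ h : ℝ) ≤ Y := by exact_mod_cast hY1
  have hY0 : (0 : ℝ) < Y := by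
    refine lt_of_lt_of_le ?_ hY1'
    positivity
  have hδ' : δ = 1 / Y := by rw [← hδ, one_div, inv_inv]
  have h1 : (h : ℝ) ^ h * cc * B ≤ (n : ℝ) ^ h / 3 := by
    calc (h : ℝ) ^ h * cc * B ≤ (h : ℝ) ^ h * (δ * (n : ℝ) ^ h) * B := by gcongr
      _ = (3 * B * h ^ h) * (n : ℝ) ^ h / (3 * Y) := by rw [hδ']; field_simp
      _ ≤ Y * (n : ℝ) ^ h / (3 * Y) := by gcongr
      _ = _ := by field_simp
  have h2 : (h : ℝ) ^ 2 * (n : ℝ) ^ (h - 1) * B ≤ (n : ℝ) ^ h / 3 := by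
    have e1 : 3 * B * h ^ 2 ≤ n := by
      refine le_trans ?_ hn
      gcongr; omega
    have e1' : (3 * B * h ^ 2 : ℝ) ≤ n := by exact_mod_cast e1
    have e2 : (n : ℝ) ^ h = n * (n : ℝ) ^ (h - 1) := by
      rw [← pow_succ', Nat.sub_add_cancel hh]
    rw [e2, le_div_iff₀ (by norm_num)]
    calc (h : ℝ) ^ 2 * (n : ℝ) ^ (h - 1) * B * 3 = (3 * B * h ^ 2) * (n : ℝ) ^ (h - 1) := by ring
      _ ≤ _ := by gcongr
  linarith

end DigraphRemoval

theorem mainTheorem2 :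
    ∀ h : ℕ, ∃ C : ℝ, 0 < C ∧
      ∀ (H : Digraph (Fin h)) (ε δ : ℝ), 0 < ε →
        δ⁻¹ = (DigraphRemoval.tower ⌈C * max 1 (Real.log (1 / ε))⌉₊ : ℝ) →
        ∀ (n : ℕ) (G : Digraph (Fin n)),
          (DigraphRemoval.copyCount H G : ℝ) ≤ δ * (n : ℝ) ^ h →
          ∃ G' : Digraph (Fin n), G' ≤ G ∧
            ((DigraphRemoval.removedEdges G G').ncard : ℝ) ≤ ε * (n : ℝ) ^ 2 ∧
            DigraphRemoval.IsFree H G' := by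
  open DigraphRemoval in
  intro h
  -- Chosen so that the height is at least j + 31 + 8S below. As ℓ ≤ 2L, the term 8S contributes 8 ·
  -- 32 · 2 = 512, and the remaining constants are 3 + 31 + 8 from j, 31 and 8S, plus 4 from 2ℓ ≤
  -- 4L.
  refine ⟨512 * h ^ 4 * (2 * h ^ 2 + 1) + 16 * h ^ 4 + 46, by positivity, ?_⟩
  intro H ε δ hε hδ n G hcopies
  set L := max 1 (Real.log (1 / ε)) with hL
  have hL1 : 1 ≤ L := le_max_left _ _
  have hLlog : Real.log (1 / ε) ≤ L := le_max_right _ _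
  set ℓ := ⌈L⌉₊ with hℓ
  have hLℓ : L ≤ ℓ := Nat.le_ceil L
  have hℓ2 : (ℓ : ℝ) ≤ 2 * L := by
    have := Nat.ceil_lt_add_one (zero_le_one.trans hL1)
    linarith
  have hℓ1 : 1 ≤ ℓ := by exact_mod_cast hL1.trans hLℓ
  set K := ⌈(512 * h ^ 4 * (2 * h ^ 2 + 1) + 16 * h ^ 4 + 46) * L⌉₊ with hK
  -- Makes `tower j` at least 16h⁴/ε, so it can serve as T.
  set j := 16 * h ^ 4 + 2 * ℓ + 3 with hj
  set S := 32 * h ^ 4 * (2 * h ^ 2 + 1) * ℓ + 1 with hS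
  have hjK : j + 31 + 8 * S ≤ K := by
    have h1 : ((j + 31 + 8 * S : ℕ) : ℝ)
        ≤ (512 * h ^ 4 * (2 * h ^ 2 + 1) + 16 * h ^ 4 + 46) * L := by
      rw [hj, hS]
      push_cast
      have e1 : 256 * (h : ℝ) ^ 4 * (2 * h ^ 2 + 1) * ℓ
          ≤ 256 * (h : ℝ) ^ 4 * (2 * h ^ 2 + 1) * (2 * L) := by gcongr
      have e2 : (16 * (h : ℝ) ^ 4 + 42) * 1 ≤ (16 * (h : ℝ) ^ 4 + 42) * L := by gcongr
      linarith
    exact Nat.cast_le.1 (h1.trans (Nat.le_ceil _))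
  set B := tower (j + 22 + 8 * S) with hB
  clear_value K S B
  have hjT : j < tower j := lt_tower j
  have hpow : h ^ 2 ≤ h ^ 4 ∧ h ≤ h ^ 2 :=
    ⟨by rcases h.eq_zero_or_pos with h0 | h0
        · simp [h0]
        · exact Nat.pow_le_pow_right h0 (by norm_num), Nat.le_self_pow (by norm_num) h⟩
  have hδ0 : 0 < δ := by
    rw [← inv_pos, hδ]; exact_mod_cast tower_pos K
  -- A single copy already forces n^h ≥ 1/δ. So n is enormous, which absorbs the noninjective maps
  -- and excludes h = 0.
  by_cases hzero : copyCount H G = 0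
  · exact ⟨G, le_rfl, by rw [removedEdges_self]; simp; positivity, isFree_of_copyCount_eq_zero hzero⟩
  have hnY : tower K ≤ n ^ h := by
    have h1 : (1 : ℝ) ≤ copyCount H G := by exact_mod_cast Nat.one_le_iff_ne_zero.2 hzero
    have h2 : δ⁻¹ ≤ (n : ℝ) ^ h := by
      rw [inv_le_iff_one_le_mul₀' hδ0]; linarith
    rw [hδ] at h2
    exact_mod_cast h2
  clear_value j
  have hh : 0 < h := by
    rcases h.eq_zero_or_pos with h0 | h0
    · have := lt_tower K
      rw [h0, pow_zero] at hnY
      omega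
    · exact h0
  -- This expression costs 9 levels beyond `B`, which explains 31 = 22 + 9.
  have hY : (3 * B * h ^ (h + 2)) ^ h ≤ tower K := by
    set i := j + 22 + 8 * S with hi
    have hjt : tower j ≤ tower i := tower_mono (by omega)
    have e1 := add_le_tower (by omega : h ≤ tower i) (by omega : 2 ≤ tower i)
    have e2 := pow_le_tower (le_tower_of_le (by omega : h ≤ tower i) (by omega : i ≤ i + 1)) e1
    have e3 := mul_le_tower (by omega : 3 ≤ tower i) hB.le
    have e4 := mul_le_tower (le_tower_of_le e3 (by omega : i + 2 ≤ i + 1 + 3)) e2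
    have e5 := pow_le_tower e4 (le_tower_of_le (by omega : h ≤ tower i) (by omega))
    exact le_tower_of_le e5 (by omega)
  have hnD : 3 * B * h ^ (h + 2) ≤ n :=
    (Nat.pow_le_pow_iff_left hh.ne').1 (hY.trans hnY)
  have hTr : 16 * (h : ℝ) ^ 4 / ε ≤ (tower j : ℝ) := by
    have e1 := inv_le_tower hε (hLlog.trans hLℓ)
    have e2 : (16 * h ^ 4) * tower (2 * ℓ + 1) ≤ tower (16 * h ^ 4 + 2 * ℓ + 1 + 2) :=
      mul_le_tower (le_tower_of_le (lt_tower _).le (by omega)) (tower_mono (by omega))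
    have e2' : (16 * (h : ℝ) ^ 4) * (tower (2 * ℓ + 1) : ℝ) ≤ (tower j : ℝ) := by
      rw [hj]; exact_mod_cast e2
    calc 16 * (h : ℝ) ^ 4 / ε = 16 * (h : ℝ) ^ 4 * (1 / ε) := by ring
      _ ≤ 16 * (h : ℝ) ^ 4 * (tower (2 * ℓ + 1) : ℝ) := by gcongr
      _ ≤ _ := e2'
  have hTn : tower j ≤ n := by
    have e1 : tower j ≤ B := hB ▸ tower_mono (by omega)
    have e2 : 1 ≤ h ^ (h + 2) := Nat.one_le_pow _ _ hh
    nlinarith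
  have hn0 : 0 < n := (tower_pos j).trans_le hTn
  -- Deleting all loops costs at most n edges, and n ≤ εn² because n ≥ `tower j` ≥ 1/ε.
  by_cases hloop : ∃ u, H.Adj u u
  · obtain ⟨u, hu⟩ := hloop
    obtain ⟨G', h1, h2, h3⟩ := exists_free_of_loop H G hu
    refine ⟨G', h1, ?_, h3⟩
    have e1 : ((removedEdges G G').ncard : ℝ) ≤ n := by exact_mod_cast h2
    have e2 : (tower j : ℝ) ≤ n := by exact_mod_cast hTn
    have e3 : (1 : ℝ) ≤ (h : ℝ) ^ 4 := by exact_mod_cast Nat.one_le_pow _ _ hh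
    have e4 : 1 ≤ ε * n := by
      rw [div_le_iff₀ hε] at hTr
      nlinarith
    have e5 : (0 : ℝ) ≤ n := by positivity
    nlinarith
  · push Not at hloop
    exact loopless_removal hh hn0 H hloop G hε (tower j) S B (tower_pos j) hTr
      (fun m hm0 hm => hS ▸ log_bound hε hL1 hLlog hLℓ hm0 hm)
      (fun m hm => hB ▸ solutionBound_le_tower (by omega) (by omega) (by omega))
      (homs_bound hh (hB ▸ tower_pos _) hδ hcopies hY hnD)
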